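/- **Theorem 2.** Let $\Gamma$ be a finitely generated amenable group. *Definitions.* A finite set $S\subset\Gamma$ is a symmetric generating set if $S=S^{-1}$ and $S$ generates $\Gamma$. For a finite set $F\subset\Gamma$ let $\partial_S F=\{x\in F: xs\notin F\text{ for some }s\in S\}$. A Følner sequence (with respect to $S$) is a sequence of non-empty finite sets $F_n\subset\Gamma$ with $|\partial_S F_n|/|F_n|\to 0$; $\Gamma$ is amenable if there is one. An *ultramatricial algebra* over a field $K$ is the direct limit $\mathcal A$ of algebras $A_n=\prod_{\alpha\in Z_n}\mathrm{Mat}_{d_\alpha\times d_\alpha}(K)$ ($n=0,1,2,\dots$; $Z_n$ finite, $d_\alpha\ge 1$) along unital diagonal embeddings $A_n\to A_{n+1}$, which place, for $\beta\in Z_{n+1}$, $K(\alpha,\beta)\ge 0$ copies of the $\alpha$-component of an element of $A_n$ as diagonal blocks in the $\beta$-component, where $d_\beta=\sum_{\alpha\in Z_n} d_\alpha K(\alpha,\beta)$. Real numbers $P(\alpha)>0$ ($\alpha \in\bigcup_n Z_n$) with $$\sum_{\alpha\in Z_n}P(\alpha)=1,\qquad P(\alpha)=\sum_{\beta\in Z_{n+1}}\frac{d_\alpha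 K(\alpha,\beta)}{d_\beta}P(\beta)\quad(\alpha\in Z_n)$$ define a rank function on $\mathcal A$ by $\mathrm{rk}\big((a_\alpha)_{\alpha\in Z_n}\big)=\sum_{\alpha\in Z_n}P(\alpha)\,\mathrm{rank}(a_\alpha)/d_\alpha$. The *rank completion* $\overline{\mathcal A}$ is the completion of $\mathcal A$ in the metric $d(x,y)=\mathrm{rk}(x-y)$, to which $\mathrm{rk}$ extends continuously. For $K=\mathbb C$ the componentwise conjugate transpose extends to an involution of $\overline{\mathcal A}$, and the involution of $\mathbb C\Gamma$ is $(\sum c_\gamma\gamma)^*=\sum\overline{c_\gamma}\,\gamma^{-1}$. *Statement.* For every field $K$ there are an ultramatricial algebra $\mathcal A$ over $K$ with a rank function as above and an injective unital $K$-algebra homomorphism $\phi:K\Gamma\to\overline{\mathcal A}$ which preserves the canonical rank of $K\Gamma$: for every $a\in K\Gamma$ and every Følner sequence $(F_n)$ of $\Gamma$ (with respect to any finite symmetric generating set), the limit $$k_a=\lim_{n\to\infty}\frac{\dim_K\{z\in K\Gamma:\ \mathrm{supp}(z)\subset F_n,\ za=0\}}{|F_n|}$$ exists and $\mathrm{rk}(\phi(a))=1-k_a$.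 If $K=\mathbb C$, then $\phi$ can moreover be chosen to be a $*$-homomorphism. -/

import Mathlib

open Filter Topology

universe u v

noncomputable section

/-! ### Ultramatricial algebras -/

/-- The combinatorial data of an ultramatricial algebra together with a rank function: a Bratteli
diagram with level sets `V n`, where the vertex `α : V n` carries the full matrix algebra indexed
by the non-empty finite set `X n α` (its size is the cardinality of `X n α`), with non-negative
integer multiplicities, a choice of diagonal embeddings, and a strictly positive harmonic
function. -/
structure UltramatricialSystem where
  /-- the vertices of level `n` -/
  V : ℕ → Type u
  [fintypeV : ∀ n, Fintype (V n)]
  [decEqV : ∀ n, DecidableEq (V n)]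
  /-- the index set of the matrix algebra at a vertex -/
  X : ∀ n, V n → Type u
  [fintypeX : ∀ n α, Fintype (X n α)]
  [decEqX : ∀ n α, DecidableEq (X n α)]
  [nonemptyX : ∀ n α, Nonempty (X n α)]
  /-- the multiplicity of the edge from `α` to `β` -/
  mult : ∀ n, V n → V (n + 1) → ℕ
  /-- the diagonal embedding into the algebra of `β`: the index set of `β` is partitioned into
  `mult n α β` copies of the index set of `α`, for all `α`; in particular
  `card (X (n + 1) β) = ∑ α, mult n α β * card (X n α)` -/
  block : ∀ n (β : V (n + 1)),
    (Σ c : (Σ α : V n, Fin (mult n α β)), X n c.1) ≃ X (n + 1) β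
  /-- the harmonic function -/
  weight : ∀ n, V n → ℝ
  weight_pos : ∀ n α, 0 < weight n α
  weight_sum : ∀ n, ∑ α, weight n α = 1
  weight_harmonic : ∀ n α, weight n α =
    ∑ β, (Fintype.card (X n α) : ℝ) * (mult n α β : ℝ) / (Fintype.card (X (n + 1) β) : ℝ) *
      weight (n + 1) β

namespace UltramatricialSystem

attribute [instance] fintypeV decEqV fintypeX decEqX nonemptyX

variable (D : UltramatricialSystem.{u}) (K : Type v) [Field K]

/-- The `n`-th algebra: the product of the matrix algebras at the vertices of level `n`. -/
abbrev Level (n : ℕ) : Type (max u v) := ∀ α : D.V n, Matrix (D.X n α) (D.X n α) K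

/-- The map from level `n` to level `n + 1`: the component at `β` is the block diagonal matrix
that contains `mult n α β` copies of the component at `α`, for all `α`. -/
def step (n : ℕ) : D.Level K n →ₐ[K] D.Level K (n + 1) where
  toFun a := fun β => Matrix.reindex (D.block n β) (D.block n β)
    (Matrix.blockDiagonal' fun c : (Σ α : D.V n, Fin (D.mult n α β)) => a c.1)
  map_one' := by
    funext β
    have h : (fun c : (Σ α : D.V n, Fin (D.mult n α β)) => (1 : D.Level K n) c.1) = 1 := rfl
    rw [h, Matrix.blockDiagonal'_one]
    simp
  map_mul' a b := by
    funext β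
    have h := Matrix.blockDiagonal'_mul
      (fun c : (Σ α : D.V n, Fin (D.mult n α β)) => a c.1) (fun c => b c.1)
    simp only [Pi.mul_apply]
    rw [h]
    simp [Matrix.submatrix_mul_equiv]
  map_zero' := by
    funext β
    have h : (fun c : (Σ α : D.V n, Fin (D.mult n α β)) => (0 : D.Level K n) c.1) = 0 := rfl
    rw [h, Matrix.blockDiagonal'_zero]
    simp
  map_add' a b := by
    funext β
    have h := Matrix.blockDiagonal'_add
      (fun c : (Σ α : D.V n, Fin (D.mult n α β)) => a c.1) (fun c => b c.1)
    have h' : (fun c : (Σ α : D.V n, Fin (D.mult n α β)) => (a + b) c.1) =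
      (fun c : (Σ α : D.V n, Fin (D.mult n α β)) => a c.1) +
        (fun c : (Σ α : D.V n, Fin (D.mult n α β)) => b c.1) := rfl
    rw [h', h]
    rfl
  commutes' r := by
    funext β
    have h' : (fun c : (Σ α : D.V n, Fin (D.mult n α β)) =>
        (algebraMap K (D.Level K n) r) c.1) = r • 1 := by
      funext c
      simp [Algebra.algebraMap_eq_smul_one]
    rw [h', Matrix.blockDiagonal'_smul, Matrix.blockDiagonal'_one]
    ext i j
    simp [Algebra.algebraMap_eq_smul_one, Matrix.smul_apply, Matrix.one_apply]

/-- The composite map from level `m` to level `n`. -/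
def trans (m n : ℕ) (h : m ≤ n) : D.Level K m →ₐ[K] D.Level K n :=
  Nat.leRecOn (C := fun k => D.Level K m →ₐ[K] D.Level K k) h
    (fun {k} g => (D.step K k).comp g) (AlgHom.id K _)

theorem coe_trans (m n : ℕ) (h : m ≤ n) :
    (D.trans K m n h : D.Level K m → D.Level K n) =
      Nat.leRecOn (C := fun k => D.Level K k) h (fun {k} => D.step K k) := by
  obtain ⟨k, rfl⟩ := Nat.exists_eq_add_of_le h
  ext x : 1
  induction k with
  | zero => simp [trans, Nat.leRecOn_self]
  | succ k ih =>
    have := ih (Nat.le_add_right m k)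
    rw [Nat.leRecOn_succ (Nat.le_add_right m k), ← this, trans,
      Nat.leRecOn_succ (Nat.le_add_right m k)]
    rfl

instance directedSystem : DirectedSystem (D.Level K) (fun i j h => D.trans K i j h) where
  map_self i x := by rw [coe_trans]; exact Nat.leRecOn_self x
  map_map i j k hij hjk x := by
    rw [coe_trans, coe_trans, coe_trans]
    exact (Nat.leRecOn_trans hij hjk x).symm

/-- The ultramatricial algebra: the direct limit of the algebras `Level n`. -/
def Alg : Type (max u v) := DirectLimit (D.Level K) (fun i j h => D.trans K i j h)

instance : Ring (D.Alg K) :=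
  inferInstanceAs (Ring (DirectLimit (D.Level K) (fun i j h => D.trans K i j h)))

instance : Algebra K (D.Alg K) :=
  inferInstanceAs (Algebra K (DirectLimit (D.Level K) (fun i j h => D.trans K i j h)))

/-- The natural map from the `n`-th algebra to the direct limit. -/
def of (n : ℕ) : D.Level K n →ₐ[K] D.Alg K where
  toFun x := (⟦⟨n, x⟩⟧ : DirectLimit (D.Level K) (fun i j h => D.trans K i j h))
  map_one' := (DirectLimit.one_def n).symm
  map_mul' _ _ := (DirectLimit.mul_def n _ _).symm
  map_zero' := (DirectLimit.zero_def n).symm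
  map_add' _ _ := (DirectLimit.add_def n _ _).symm
  commutes' r := (DirectLimit.algebraMap_def n r).symm

/-! ### The rank function -/

variable {K}

/-- The rank of an element of the `n`-th algebra. -/
def levelRank (n : ℕ) (a : D.Level K n) : ℝ :=
  ∑ α, D.weight n α * (((a α).rank : ℝ) / (Fintype.card (D.X n α) : ℝ))

theorem rank_add_le {m : Type*} [Fintype m] (A B : Matrix m m K) :
    (A + B).rank ≤ A.rank + B.rank := by
  classical
  have h : LinearMap.range (A + B).mulVecLin ≤
      LinearMap.range A.mulVecLin ⊔ LinearMap.range B.mulVecLin := by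
    rintro _ ⟨x, rfl⟩
    rw [Matrix.mulVecLin_add]
    exact Submodule.add_mem_sup ⟨x, rfl⟩ ⟨x, rfl⟩
  exact (Submodule.finrank_mono h).trans (Submodule.finrank_add_le_finrank_add_finrank _ _)

theorem rank_neg {m : Type*} [Fintype m] (A : Matrix m m K) : (-A).rank = A.rank := by
  have h : LinearMap.range (-A).mulVecLin = LinearMap.range A.mulVecLin := by
    have : (-A).mulVecLin = -A.mulVecLin := by
      ext x; simp
    rw [this, LinearMap.range_neg]
  unfold Matrix.rank
  rw [h]

theorem eq_zero_of_rank {m : Type*} [Fintype m] (A : Matrix m m K) (h : A.rank = 0) : A = 0 := by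
  classical
  have h1 : LinearMap.range A.mulVecLin = ⊥ := Submodule.finrank_eq_zero.mp h
  have h2 : A.mulVecLin = 0 := LinearMap.range_eq_bot.mp h1
  ext i j
  have := congrFun (LinearMap.congr_fun h2 (Pi.single j 1)) i
  simpa using this

theorem rank_blockDiagonal' {ι : Type*} [Fintype ι] [DecidableEq ι] {m : ι → Type*}
    [∀ i, Fintype (m i)] [∀ i, DecidableEq (m i)] (A : ∀ i, Matrix (m i) (m i) K) :
    (Matrix.blockDiagonal' A).rank = ∑ i, (A i).rank := by
  have key : ∀ (x : (Σ i, m i) → K) (i : ι) (p : m i),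
      (Matrix.blockDiagonal' A).mulVec x ⟨i, p⟩ = (A i).mulVec (fun q => x ⟨i, q⟩) p := by
    intro x i p
    simp only [Matrix.mulVec, dotProduct, Fintype.sum_sigma]
    rw [Finset.sum_eq_single i]
    · simp [Matrix.blockDiagonal'_apply_eq]
    · intro j _ hj
      exact Finset.sum_eq_zero fun q _ => by
        rw [Matrix.blockDiagonal'_apply_ne _ _ _ hj.symm, zero_mul]
    · simp
  unfold Matrix.rank
  rw [← Module.finrank_pi_fintype K]
  refine LinearEquiv.finrank_eq (LinearEquiv.ofBijective
    (LinearMap.pi fun i => LinearMap.codRestrict (LinearMap.range (A i).mulVecLin)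
      ((LinearMap.funLeft K K (fun q : m i => (⟨i, q⟩ : Σ i, m i))).comp
        (Submodule.subtype _)) ?_) ⟨?_, ?_⟩)
  · rintro ⟨_, x, rfl⟩
    refine ⟨fun q => x ⟨i, q⟩, ?_⟩
    funext p
    exact (key x i p).symm
  · intro y z h
    ext ⟨i, p⟩
    exact congrFun (congrArg Subtype.val (congrFun h i)) p
  · intro y
    choose w hw using fun i => (y i).2
    refine ⟨⟨_, fun s => w s.1 s.2, rfl⟩, ?_⟩
    funext i
    apply Subtype.ext
    rw [← hw i]
    funext p
    exact key _ i p

theorem levelRank_zero (n : ℕ) : D.levelRank n (0 : D.Level K n) = 0 := by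
  simp [levelRank]

theorem levelRank_neg (n : ℕ) (a : D.Level K n) : D.levelRank n (-a) = D.levelRank n a := by
  simp [levelRank, rank_neg]

theorem levelRank_add (n : ℕ) (a b : D.Level K n) :
    D.levelRank n (a + b) ≤ D.levelRank n a + D.levelRank n b := by
  unfold levelRank
  rw [← Finset.sum_add_distrib]
  refine Finset.sum_le_sum fun α _ => ?_
  rw [← mul_add, ← add_div]
  have := D.weight_pos n α
  have h : ((a α + b α).rank : ℝ) ≤ (a α).rank + (b α).rank := by
    exact_mod_cast rank_add_le (a α) (b α)
  have h' : (a + b) α = a α + b α := rfl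
  rw [h']
  gcongr

theorem levelRank_mul_left (n : ℕ) (a b : D.Level K n) :
    D.levelRank n (a * b) ≤ D.levelRank n a := by
  refine Finset.sum_le_sum fun α _ => ?_
  have := D.weight_pos n α
  have h : (((a * b) α).rank : ℝ) ≤ (a α).rank := by
    exact_mod_cast Matrix.rank_mul_le_left (a α) (b α)
  gcongr

theorem levelRank_mul_right (n : ℕ) (a b : D.Level K n) :
    D.levelRank n (a * b) ≤ D.levelRank n b := by
  refine Finset.sum_le_sum fun α _ => ?_
  have := D.weight_pos n α
  have h : (((a * b) α).rank : ℝ) ≤ (b α).rank := by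
    exact_mod_cast Matrix.rank_mul_le_right (a α) (b α)
  gcongr

theorem eq_zero_of_levelRank (n : ℕ) (a : D.Level K n) (h : D.levelRank n a = 0) : a = 0 := by
  unfold levelRank at h
  rw [Finset.sum_eq_zero_iff_of_nonneg
    (fun α _ => mul_nonneg (D.weight_pos n α).le (by positivity))] at h
  funext α
  apply eq_zero_of_rank
  have h1 := h α (Finset.mem_univ _)
  have h2 : (Fintype.card (D.X n α) : ℝ) ≠ 0 := by
    exact_mod_cast Fintype.card_ne_zero
  have h3 := (D.weight_pos n α).ne'
  simpa [h2, h3] using h1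

theorem levelRank_step (n : ℕ) (a : D.Level K n) :
    D.levelRank (n + 1) (D.step K n a) = D.levelRank n a := by
  have h : ∀ β, ((D.step K n a β).rank : ℝ) = ∑ α, (D.mult n α β : ℝ) * (a α).rank := by
    intro β
    have : (D.step K n a β).rank = ∑ α, D.mult n α β * (a α).rank := by
      have h1 : D.step K n a β = Matrix.reindex (D.block n β) (D.block n β)
        (Matrix.blockDiagonal' fun c : (Σ α : D.V n, Fin (D.mult n α β)) => a c.1) := rfl
      rw [h1, Matrix.rank_reindex, rank_blockDiagonal', Fintype.sum_sigma]
      refine Finset.sum_congr rfl fun α _ => ?_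
      change ∑ _y : Fin (D.mult n α β), (a α).rank = _
      rw [Finset.sum_const, Finset.card_univ, Fintype.card_fin, smul_eq_mul]
    exact_mod_cast this
  unfold levelRank
  simp_rw [h]
  conv_rhs => enter [2, α]; rw [D.weight_harmonic n α]
  simp_rw [Finset.sum_div, Finset.mul_sum, Finset.sum_mul]
  rw [Finset.sum_comm]
  refine Finset.sum_congr rfl fun α _ => Finset.sum_congr rfl fun β _ => ?_
  have h2 : (Fintype.card (D.X n α) : ℝ) ≠ 0 := by
    exact_mod_cast Fintype.card_ne_zero
  field_simp

theorem levelRank_trans (m n : ℕ) (h : m ≤ n) (a : D.Level K m) :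
    D.levelRank n (D.trans K m n h a) = D.levelRank m a := by
  obtain ⟨k, rfl⟩ := Nat.exists_eq_add_of_le h
  induction k with
  | zero => simp [trans, Nat.leRecOn_self]
  | succ k ih =>
    rw [← ih (Nat.le_add_right m k), ← D.levelRank_step (m + k)]
    have e : D.trans K m (m + (k + 1)) h =
        (D.step K (m + k)).comp (D.trans K m (m + k) (Nat.le_add_right m k)) :=
      Nat.leRecOn_succ (Nat.le_add_right m k) _
    rw [e]
    rfl

/-- The rank function of the ultramatricial algebra. -/
def rank : D.Alg K → ℝ :=
  DirectLimit.lift _ (fun n a => D.levelRank n a) fun i j h a => (D.levelRank_trans i j h a).symm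

@[simp] theorem rank_of (n : ℕ) (a : D.Level K n) : D.rank (D.of K n a) = D.levelRank n a := rfl

theorem exists_of (x : D.Alg K) : ∃ n a, x = D.of K n a :=
  DirectLimit.exists_eq_mk _ x

theorem exists_of₂ (x y : D.Alg K) : ∃ n a b, x = D.of K n a ∧ y = D.of K n b :=
  DirectLimit.exists_eq_mk₂ _ x y

theorem rank_mul_left (x y : D.Alg K) : D.rank (x * y) ≤ D.rank x := by
  obtain ⟨n, a, b, rfl, rfl⟩ := D.exists_of₂ x y
  rw [← map_mul, rank_of, rank_of]
  exact D.levelRank_mul_left n a b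

theorem rank_mul_right (x y : D.Alg K) : D.rank (x * y) ≤ D.rank y := by
  obtain ⟨n, a, b, rfl, rfl⟩ := D.exists_of₂ x y
  rw [← map_mul, rank_of, rank_of]
  exact D.levelRank_mul_right n a b

variable (K)

/-- The rank as an additive group norm, so that `dist x y = rank (x - y)`. -/
def rankNorm : AddGroupNorm (D.Alg K) where
  toFun := D.rank
  map_zero' := by rw [← map_zero (D.of K 0), rank_of, levelRank_zero]
  add_le' x y := by
    obtain ⟨n, a, b, rfl, rfl⟩ := D.exists_of₂ x y
    rw [← map_add, rank_of, rank_of, rank_of]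
    exact D.levelRank_add n a b
  neg' x := by
    obtain ⟨n, a, rfl⟩ := D.exists_of x
    rw [← map_neg, rank_of, rank_of, levelRank_neg]
  eq_zero_of_map_eq_zero' x h := by
    obtain ⟨n, a, rfl⟩ := D.exists_of x
    rw [rank_of] at h
    rw [D.eq_zero_of_levelRank n a h, map_zero]

/-- The rank metric on the ultramatricial algebra: `‖x‖ = rank x` and `dist x y = rank (x - y)`. -/
instance : NormedAddCommGroup (D.Alg K) :=
  { (D.rankNorm K).toNormedAddCommGroup, (inferInstance : Ring (D.Alg K)) with }

theorem norm_def (x : D.Alg K) : ‖x‖ = D.rank x := rfl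

theorem dist_def (x y : D.Alg K) : dist x y = D.rank (x - y) := by
  rw [dist_eq_norm, norm_def]

instance : ContinuousMul (D.Alg K) where
  continuous_mul := by
    rw [continuous_iff_continuousAt]
    rintro ⟨x₀, y₀⟩
    rw [ContinuousAt, tendsto_iff_norm_sub_tendsto_zero]
    have h1 : Tendsto (fun p : D.Alg K × D.Alg K => ‖p.1 - x₀‖ + ‖p.2 - y₀‖) (𝓝 (x₀, y₀))
        (𝓝 0) := by
      have : Continuous (fun p : D.Alg K × D.Alg K => ‖p.1 - x₀‖ + ‖p.2 - y₀‖) := by fun_prop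
      simpa using this.tendsto (x₀, y₀)
    refine squeeze_zero (fun _ => norm_nonneg _) (fun p => ?_) h1
    have e : p.1 * p.2 - x₀ * y₀ = (p.1 - x₀) * p.2 + x₀ * (p.2 - y₀) := by noncomm_ring
    calc ‖p.1 * p.2 - x₀ * y₀‖ ≤ ‖(p.1 - x₀) * p.2‖ + ‖x₀ * (p.2 - y₀)‖ := by
          rw [e]; exact norm_add_le _ _
      _ ≤ ‖p.1 - x₀‖ + ‖p.2 - y₀‖ :=
          add_le_add (D.rank_mul_left _ _) (D.rank_mul_right _ _)

instance : IsTopologicalRing (D.Alg K) where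

instance : UniformContinuousConstSMul K (D.Alg K) where
  uniformContinuous_const_smul c := by
    refine (LipschitzWith.of_dist_le_mul (K := 1) fun x y => ?_).uniformContinuous
    rw [dist_def, dist_def, ← smul_sub, Algebra.smul_def, NNReal.coe_one, one_mul]
    exact D.rank_mul_right _ _

/-- The rank completion: the completion of the ultramatricial algebra in the rank metric. -/
abbrev RankCompletion : Type (max u v) := UniformSpace.Completion (D.Alg K)

variable {K}

/-- The rank function of the rank completion, that is the distance from zero; it is the
continuous extension of the rank function of the ultramatricial algebra. -/
def completionRank (x : D.RankCompletion K) : ℝ := dist x 0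

theorem continuous_completionRank : Continuous (D.completionRank (K := K)) :=
  continuous_id.dist continuous_const

theorem completionRank_coe (x : D.Alg K) :
    D.completionRank (x : D.RankCompletion K) = D.rank x := by
  rw [completionRank, ← UniformSpace.Completion.coe_zero, UniformSpace.Completion.dist_eq,
    dist_def, sub_zero]

/-! ### The involution over the complex numbers -/

theorem step_star (n : ℕ) (a : D.Level ℂ n) : D.step ℂ n (star a) = star (D.step ℂ n a) := by
  funext β
  have h1 : ∀ a : D.Level ℂ n, D.step ℂ n a β = Matrix.reindex (D.block n β) (D.block n β)
        (Matrix.blockDiagonal' fun c : (Σ α : D.V n, Fin (D.mult n α β)) => a c.1) := fun _ => rfl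
  rw [Pi.star_apply, h1, h1, Matrix.star_eq_conjTranspose, Matrix.conjTranspose_reindex,
    Matrix.blockDiagonal'_conjTranspose]
  rfl

theorem trans_star (m n : ℕ) (h : m ≤ n) (a : D.Level ℂ m) :
    D.trans ℂ m n h (star a) = star (D.trans ℂ m n h a) := by
  obtain ⟨k, rfl⟩ := Nat.exists_eq_add_of_le h
  induction k with
  | zero => simp [trans, Nat.leRecOn_self]
  | succ k ih =>
    have e : D.trans ℂ m (m + (k + 1)) h =
        (D.step ℂ (m + k)).comp (D.trans ℂ m (m + k) (Nat.le_add_right m k)) :=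
      Nat.leRecOn_succ (Nat.le_add_right m k) _
    rw [e, AlgHom.comp_apply, AlgHom.comp_apply, ih (Nat.le_add_right m k), step_star]

/-- The involution of the complex ultramatricial algebra, which at every level is the
componentwise conjugate transpose. -/
instance : Star (D.Alg ℂ) where
  star := DirectLimit.map (fun i j h => D.trans ℂ i j h) (fun i j h => D.trans ℂ i j h)
    (fun _ a => star a) fun i j h a => D.trans_star i j h a

theorem star_of (n : ℕ) (a : D.Level ℂ n) : star (D.of ℂ n a) = D.of ℂ n (star a) := rfl

instance : StarRing (D.Alg ℂ) where
  star_involutive x := by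
    obtain ⟨n, a, rfl⟩ := D.exists_of x
    rw [star_of, star_of, star_star]
  star_mul x y := by
    obtain ⟨n, a, b, rfl, rfl⟩ := D.exists_of₂ x y
    rw [← map_mul, star_of, star_of, star_of, ← map_mul, star_mul]
  star_add x y := by
    obtain ⟨n, a, b, rfl, rfl⟩ := D.exists_of₂ x y
    rw [← map_add, star_of, star_of, star_of, ← map_add, star_add]

open scoped ComplexOrder in
theorem rank_star (x : D.Alg ℂ) : D.rank (star x) = D.rank x := by
  obtain ⟨n, a, rfl⟩ := D.exists_of x
  rw [star_of, rank_of, rank_of]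
  unfold levelRank
  refine Finset.sum_congr rfl fun α _ => ?_
  rw [Pi.star_apply, Matrix.star_eq_conjTranspose, Matrix.rank_conjTranspose]

theorem isometry_star : Isometry (star : D.Alg ℂ → D.Alg ℂ) :=
  Isometry.of_dist_eq fun x y => by rw [dist_def, dist_def, ← star_sub, rank_star]

/-- The involution of the complex rank completion, by continuous extension. -/
instance : Star (D.RankCompletion ℂ) where
  star := UniformSpace.Completion.map star

theorem star_coe (x : D.Alg ℂ) :
    star (x : D.RankCompletion ℂ) = ((star x : D.Alg ℂ) : D.RankCompletion ℂ) :=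
  UniformSpace.Completion.map_coe D.isometry_star.uniformContinuous x

instance : ContinuousStar (D.RankCompletion ℂ) where
  continuous_star := UniformSpace.Completion.continuous_map

instance : StarRing (D.RankCompletion ℂ) where
  star_involutive x := by
    induction x using UniformSpace.Completion.induction_on with
    | hp => exact isClosed_eq (by fun_prop) (by fun_prop)
    | ih x => rw [star_coe, star_coe, star_star]
  star_mul x y := by
    induction x, y using UniformSpace.Completion.induction_on₂ with
    | hp => exact isClosed_eq (by fun_prop) (by fun_prop)
    | ih x y =>
      rw [← UniformSpace.Completion.coe_mul, star_coe, star_coe, star_coe,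
        ← UniformSpace.Completion.coe_mul, star_mul]
  star_add x y := by
    induction x, y using UniformSpace.Completion.induction_on₂ with
    | hp => exact isClosed_eq (by fun_prop) (by fun_prop)
    | ih x y =>
      rw [← UniformSpace.Completion.coe_add, star_coe, star_coe, star_coe,
        ← UniformSpace.Completion.coe_add, star_add]

end UltramatricialSystem

/-! ### Amenable groups and the canonical rank of the group algebra -/

section GroupAlgebra

variable {Γ : Type u} [Group Γ]

/-- `S` is a finite symmetric generating set of the group. -/
def IsSymmetricGenerating (S : Finset Γ) : Prop :=
  (∀ s ∈ S, s⁻¹ ∈ S) ∧ Subgroup.closure (S : Set Γ) = ⊤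

open Classical in
/-- The boundary of `F` in the Cayley graph with edges `(x, x * s)`: the vertices in `F` that are
adjacent to a vertex in the complement of `F`. -/
def cayleyBoundary (S F : Finset Γ) : Finset Γ := F.filter fun x => ∃ s ∈ S, x * s ∉ F

/-- A Følner sequence: non-empty finite sets whose isoperimetric constants tend to zero. -/
def IsFolnerSequence (S : Finset Γ) (F : ℕ → Finset Γ) : Prop :=
  (∀ n, (F n).Nonempty) ∧
    Tendsto (fun n => ((cayleyBoundary S (F n)).card : ℝ) / ((F n).card : ℝ)) atTop (𝓝 0)

variable (Γ) in
/-- Amenability of a finitely generated group: for some finite symmetric generating set there is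
a Følner sequence. -/
def IsAmenableGroup : Prop :=
  ∃ S : Finset Γ, IsSymmetricGenerating S ∧ ∃ F : ℕ → Finset Γ, IsFolnerSequence S F

variable {K : Type v} [Field K]

/-- The space of the elements `z` of the group algebra that are supported on `F` and satisfy
`z * a = 0`. -/
def annihilatorOn (F : Finset Γ) (a : MonoidAlgebra K Γ) : Submodule K (MonoidAlgebra K Γ) where
  carrier := {z | (∀ γ, γ ∉ F → z.coeff γ = 0) ∧ z * a = 0}
  zero_mem' := by simp
  add_mem' {x y} hx hy :=
    ⟨fun γ h => by simp [hx.1 γ h, hy.1 γ h], by rw [add_mul, hx.2, hy.2, add_zero]⟩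
  smul_mem' c x hx := ⟨fun γ h => by simp [hx.1 γ h], by rw [smul_mul_assoc, hx.2, smul_zero]⟩

/-- `r` is the canonical rank of the element `a` of the group algebra of an amenable group: along
every Følner sequence, `dim {z supported on F n | z * a = 0} / |F n|` tends to `1 - r`. -/
def IsFolnerRank (a : MonoidAlgebra K Γ) (r : ℝ) : Prop :=
  ∀ S : Finset Γ, IsSymmetricGenerating S → ∀ F : ℕ → Finset Γ, IsFolnerSequence S F →
    Tendsto (fun n => (Module.finrank K (annihilatorOn (F n) a) : ℝ) / ((F n).card : ℝ))
      atTop (𝓝 (1 - r))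

/-- The involution of the complex group algebra: `(∑ c_γ γ)^* = ∑ conj(c_γ) γ⁻¹`. -/
def groupAlgebraStar (a : MonoidAlgebra ℂ Γ) : MonoidAlgebra ℂ Γ :=
  a.coeff.sum fun γ c => MonoidAlgebra.single γ⁻¹ (star c)

end GroupAlgebra

end

/-! Right multiplication by `a` commutes with left translations. Its compression to a finite set `F`
is the matrix with entries `a.coeff (x⁻¹ * y)`, the same for all left translates of `F`. Compression
is linear and respects `1` and the involution. It fails to be multiplicative only in rows `x` for
which `x * supp a` leaves `F`, an error of small relative rank when `F` is almost invariant.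

If `F` is partitioned into left translates of smaller almost invariant tiles, its compression
differs from the block diagonal matrix of the compressions to the tiles only in rows near tile
boundaries. Hence finite families of tiles, each family tiling the members of the next, form a
Bratteli diagram in which the compressions of `a` are a Cauchy sequence for the rank metric; the
limit is `φ a`.

The tilings come from the Ornstein–Weiss quasi-tiling theorem (`exists_quasiTiling`): an almost
invariant set is covered, up to a small part, by disjoint large parts of translates of finitely many
tiles. Admitting these large parts as tiles and the uncovered points as singletons makes the tiling
exact. The same theorem shows that invariant subadditive set functions have a mean along almost
invariant sets; applied to the dimension of `span {x * a : x ∈ F}`, this gives the canonical rank.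

The rank function on the diagram is a harmonic weight obtained by compactness, with mass at most `(1
/ 2) ^ n` on the singleton of level `n`. The rank of the level `n` approximation is then an average
of normalized ranks almost all of which are close to the canonical rank. Injectivity follows because
the canonical rank of `a ≠ 0` is at least `1 / |supp a|`. -/

/-! ### Boundaries and the Følner filter -/

section Quasitiling

open scoped Pointwise
open scoped Classical

variable {Γ : Type u} [Group Γ]

/-- The number of points of `F` that leave `F` under right multiplication by `b`. -/
noncomputable def escape (b : Γ) (F : Finset Γ) : ℕ := (F.filter fun x => x * b ∉ F).card

theorem escape_le_card (b : Γ) (F : Finset Γ) : escape b F ≤ F.card := Finset.card_filter_le _ _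

theorem escape_one (F : Finset Γ) : escape 1 F = 0 := by
  simp only [escape, mul_one, Finset.card_eq_zero, Finset.filter_eq_empty_iff, not_not]
  exact fun _ h => h

/-- Flow in is at most flow out: right multiplication by `b` maps `S` and the points of `F` that
stay in `F`, which are disjoint, injectively into `F`. -/
theorem card_le_escape_of_entry (b : Γ) (F S : Finset Γ) (hS : ∀ x ∈ S, x ∉ F ∧ x * b ∈ F) :
    S.card ≤ escape b F := by
  have h1 : (F.filter fun x => x * b ∈ F).card + escape b F = F.card :=
    Finset.card_filter_add_card_filter_not _
  have hd : Disjoint S (F.filter fun x => x * b ∈ F) :=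
    Finset.disjoint_left.2 fun x hx hx' => (hS x hx).1 (Finset.mem_filter.1 hx').1
  have h2 : (S ∪ F.filter fun x => x * b ∈ F).card ≤ F.card := by
    refine Finset.card_le_card_of_injOn (fun x => x * b) ?_ (fun x _ y _ h => mul_right_cancel h)
    intro x hx
    rcases Finset.mem_union.1 hx with h | h
    · exact (hS x h).2
    · exact (Finset.mem_filter.1 h).2
  rw [Finset.card_union_of_disjoint hd] at h2
  omega

theorem escape_mul_le (b c : Γ) (F : Finset Γ) : escape (b * c) F ≤ escape b F + escape c F := by
  have h1 : (F.filter fun x => x * (b * c) ∉ F) ⊆ (F.filter fun x => x * b ∉ F) ∪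
      (F.filter fun x => x * b ∈ F ∧ x * b * c ∉ F) := by
    intro x hx
    rw [Finset.mem_filter, ← mul_assoc] at hx
    by_cases h : x * b ∈ F
    · exact Finset.mem_union_right _ (Finset.mem_filter.2 ⟨hx.1, h, hx.2⟩)
    · exact Finset.mem_union_left _ (Finset.mem_filter.2 ⟨hx.1, h⟩)
  refine (Finset.card_le_card h1).trans ((Finset.card_union_le _ _).trans ?_)
  refine Nat.add_le_add_left ?_ _
  refine Finset.card_le_card_of_injOn (fun x => x * b) ?_ (fun x _ y _ h => mul_right_cancel h)
  intro x hx
  simp only [Finset.coe_filter, Set.mem_ofPred_eq] at hx ⊢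
  exact hx.2

theorem escape_inv_le (b : Γ) (F : Finset Γ) : escape b⁻¹ F ≤ escape b F := by
  have h := card_le_escape_of_entry b F ((F.filter fun x => x * b⁻¹ ∉ F).image fun x => x * b⁻¹) (by
    intro x hx
    obtain ⟨y, hy, rfl⟩ := Finset.mem_image.1 hx
    rw [Finset.mem_filter] at hy
    exact ⟨hy.2, by simpa using hy.1⟩)
  rwa [Finset.card_image_of_injective _ (mul_left_injective b⁻¹)] at h

theorem escape_smul (b c : Γ) (F : Finset Γ) : escape b (c • F) = escape b F := by
  have h : ((c • F).filter fun x => x * b ∉ c • F) = c • (F.filter fun x => x * b ∉ F) := by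
    ext x
    simp only [Finset.mem_filter, ← Finset.inv_smul_mem_iff, smul_eq_mul, mul_assoc]
  rw [escape, h, Finset.card_smul_finset, escape]

/-- A point that leaves `A` either leaves `T` or lands in `T \ A`. This keeps slightly trimmed tiles
almost invariant. -/
theorem escape_trim_le (b : Γ) {A T : Finset Γ} (h : A ⊆ T) :
    escape b A ≤ escape b T + (T \ A).card := by
  have h1 : (A.filter fun x => x * b ∉ A) ⊆ (T.filter fun x => x * b ∉ T) ∪
      (A.filter fun x => x * b ∈ T \ A) := by
    intro x hx
    rw [Finset.mem_filter] at hx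
    by_cases hb : x * b ∈ T
    · exact Finset.mem_union_right _ (Finset.mem_filter.2 ⟨hx.1, Finset.mem_sdiff.2 ⟨hb, hx.2⟩⟩)
    · exact Finset.mem_union_left _ (Finset.mem_filter.2 ⟨h hx.1, hb⟩)
  refine (Finset.card_le_card h1).trans ((Finset.card_union_le _ _).trans ?_)
  refine Nat.add_le_add_left ?_ _
  refine Finset.card_le_card_of_injOn (fun x => x * b) ?_ (fun x _ y _ h => mul_right_cancel h)
  intro x hx
  exact (Finset.mem_filter.1 hx).2

variable (Γ) in
/-- The filter of almost invariant non-empty finite sets. -/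
def folnerFilter : Filter (Finset Γ) where
  sets := {W | ∃ B : Finset Γ, ∃ δ : ℝ, 0 < δ ∧ ∀ F : Finset Γ, F.Nonempty →
    (∑ b ∈ B, (escape b F : ℝ)) ≤ δ * F.card → F ∈ W}
  univ_sets := ⟨∅, 1, one_pos, fun _ _ _ => trivial⟩
  sets_of_superset := by
    rintro x y ⟨B, δ, hδ, h⟩ hxy
    exact ⟨B, δ, hδ, fun F hF h' => hxy (h F hF h')⟩
  inter_sets := by
    rintro x y ⟨B, δ, hδ, h⟩ ⟨B', δ', hδ', h'⟩
    refine ⟨B ∪ B', min δ δ', lt_min hδ hδ', fun F hF hB => ⟨h F hF ?_, h' F hF ?_⟩⟩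
    · refine (Finset.sum_le_sum_of_subset_of_nonneg Finset.subset_union_left
        fun _ _ _ => Nat.cast_nonneg _).trans (hB.trans ?_)
      gcongr
      exact min_le_left _ _
    · refine (Finset.sum_le_sum_of_subset_of_nonneg Finset.subset_union_right
        fun _ _ _ => Nat.cast_nonneg _).trans (hB.trans ?_)
      gcongr
      exact min_le_right _ _

theorem eventually_folner_iff {p : Finset Γ → Prop} : (∀ᶠ F in folnerFilter Γ, p F) ↔
    ∃ B : Finset Γ, ∃ δ : ℝ, 0 < δ ∧ ∀ F : Finset Γ, F.Nonempty →
      (∑ b ∈ B, (escape b F : ℝ)) ≤ δ * F.card → p F := Iff.rfl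

theorem eventually_folner_nonempty : ∀ᶠ F in folnerFilter Γ, F.Nonempty :=
  eventually_folner_iff.2 ⟨∅, 1, one_pos, fun _ h _ => h⟩

theorem eventually_sum_escape_le (B : Finset Γ) {δ : ℝ} (hδ : 0 < δ) :
    ∀ᶠ F in folnerFilter Γ, (∑ b ∈ B, (escape b F : ℝ)) ≤ δ * F.card :=
  eventually_folner_iff.2 ⟨B, δ, hδ, fun _ _ h => h⟩

/-! ### Quasi-tilings -/

/-- A family of disjoint sets, each of which is a large part of a translate of `T`, such that the
translates are contained in the union of the family. -/
structure IsPacking (ε : ℝ) (T R : Finset Γ) (P : Finset (Finset Γ)) : Prop where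
  disjoint : (P : Set (Finset Γ)).PairwiseDisjoint id
  piece : ∀ A ∈ P, ∃ c : Γ, A ⊆ c • T ∧ c • T ⊆ P.biUnion id ∧ (1 - ε) * T.card ≤ A.card
  subset : P.biUnion id ⊆ R

/-- A packing with the largest number of pieces works: a translate in `R` meeting the union in at
most `ε * |T|` points would contribute its uncovered part as a further piece. -/
theorem exists_isPacking_maximal {ε : ℝ} (hε : ε < 1) {T : Finset Γ} (hT : T.Nonempty)
    (R : Finset Γ) : ∃ P, IsPacking ε T R P ∧
      ∀ c : Γ, c • T ⊆ R → ε * T.card < ((c • T) ∩ P.biUnion id).card := by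
  have hfin : {P | IsPacking ε T R P}.Finite := by
    refine (Finset.finite_toSet (R.powerset.powerset)).subset fun P hP => ?_
    simp only [Finset.mem_coe, Finset.mem_powerset]
    exact fun A hA => Finset.mem_powerset.2 ((Finset.subset_biUnion_of_mem id hA).trans hP.subset)
  have hne : {P | IsPacking ε T R P}.Nonempty := ⟨∅, by simp, by simp, by simp⟩
  obtain ⟨P, hP, hmax⟩ := hfin.exists_maximalFor Finset.card _ hne
  refine ⟨P, hP, fun c hc => ?_⟩
  by_contra! hlt
  set U := P.biUnion id with hU
  have hTpos : (0 : ℝ) < T.card := by exact_mod_cast hT.card_pos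
  have hcard : ((c • T) \ U).card + ((c • T) ∩ U).card = T.card := by
    rw [Finset.card_sdiff_add_card_inter, Finset.card_smul_finset]
  have hcard' : (((c • T) \ U).card : ℝ) + ((c • T) ∩ U).card = T.card := by exact_mod_cast hcard
  have hbig : (1 - ε) * T.card ≤ ((c • T) \ U).card := by linarith
  have hpos : 0 < ((c • T) \ U).card := by
    have : (0 : ℝ) < ((c • T) \ U).card := lt_of_lt_of_le (mul_pos (by linarith) hTpos) hbig
    exact_mod_cast this
  have hnot : (c • T) \ U ∉ P := by
    intro h
    obtain ⟨x, hx⟩ := Finset.card_pos.1 hpos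
    exact (Finset.mem_sdiff.1 hx).2 (Finset.mem_biUnion.2 ⟨_, h, hx⟩)
  -- Although the new piece is trimmed, the union grows by the full translate; this preserves the
  -- middle clause of `IsPacking.piece`.
  have hUnion : (insert ((c • T) \ U) P).biUnion id = (c • T) ∪ U := by
    rw [Finset.biUnion_insert, id, ← hU, Finset.sdiff_union_self_eq_union]
  have hnew : IsPacking ε T R (insert ((c • T) \ U) P) := by
    refine ⟨?_, ?_, ?_⟩
    · rw [Finset.coe_insert]
      refine hP.disjoint.insert fun A hA _ => ?_
      exact Finset.sdiff_disjoint.mono_right (Finset.subset_biUnion_of_mem id hA)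
    · intro A hA
      rw [hUnion]
      rcases Finset.mem_insert.1 hA with rfl | hA
      · exact ⟨c, Finset.sdiff_subset, Finset.subset_union_left, hbig⟩
      · obtain ⟨d, h1, h2, h3⟩ := hP.piece A hA
        exact ⟨d, h1, h2.trans Finset.subset_union_right, h3⟩
    · rw [hUnion]
      exact Finset.union_subset hc hP.subset
  have := hmax hnew
  simp only [Finset.card_insert_of_notMem hnot] at this
  omega

theorem IsPacking.card_mul_le {ε : ℝ} {T R : Finset Γ} {P : Finset (Finset Γ)}
    (h : IsPacking ε T R P) : (P.card : ℝ) * ((1 - ε) * T.card) ≤ R.card := by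
  have h1 : ((P.biUnion id).card : ℝ) = ∑ A ∈ P, (A.card : ℝ) := by
    rw [Finset.card_biUnion h.disjoint]; push_cast; rfl
  have h2 : (P.card : ℝ) * ((1 - ε) * T.card) ≤ ∑ A ∈ P, (A.card : ℝ) := by
    rw [← nsmul_eq_mul]
    refine Finset.card_nsmul_le_sum _ _ _ fun A hA => ?_
    obtain ⟨c, -, -, h3⟩ := h.piece A hA
    exact h3
  rw [← h1] at h2
  exact h2.trans (by exact_mod_cast Finset.card_le_card h.subset)

/-- A point of `R \ U` moved by `b` into `U` enters a translate `c • T` that lies entirely in `U`,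
so it is counted by the flow into that translate. Trimmed pieces alone would give no such bound. -/
theorem IsPacking.escape_sdiff_le {ε : ℝ} {T R : Finset Γ} {P : Finset (Finset Γ)}
    (h : IsPacking ε T R P) (b : Γ) :
    escape b (R \ P.biUnion id) ≤ escape b R + P.card * escape b T := by
  choose! c hc using h.piece
  set U := P.biUnion id
  have h1 : ((R \ U).filter fun x => x * b ∉ R \ U) ⊆ (R.filter fun x => x * b ∉ R) ∪
      P.biUnion fun A => (R \ U).filter fun x => x * b ∈ c A • T := by
    intro x hx
    rw [Finset.mem_filter] at hx
    have hxR := (Finset.mem_sdiff.1 hx.1).1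
    by_cases hb : x * b ∈ R
    · have hbU : x * b ∈ U := by
        by_contra hcon
        exact hx.2 (Finset.mem_sdiff.2 ⟨hb, hcon⟩)
      obtain ⟨A, hA, hxA⟩ := Finset.mem_biUnion.1 hbU
      refine Finset.mem_union_right _ (Finset.mem_biUnion.2 ⟨A, hA, Finset.mem_filter.2 ⟨hx.1, ?_⟩⟩)
      exact (hc A hA).1 hxA
    · exact Finset.mem_union_left _ (Finset.mem_filter.2 ⟨hxR, hb⟩)
  refine (Finset.card_le_card h1).trans ((Finset.card_union_le _ _).trans ?_)
  refine Nat.add_le_add_left (Finset.card_biUnion_le_card_mul _ _ _ fun A hA => ?_) _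
  rw [← escape_smul b (c A) T]
  refine card_le_escape_of_entry b _ _ fun x hx => ?_
  rw [Finset.mem_filter, Finset.mem_sdiff] at hx
  exact ⟨fun hx' => hx.1.2 ((hc A hA).2.1 hx'), hx.2⟩

theorem card_filter_not_smul_subset_le (T R : Finset Γ) :
    (R.filter fun c => ¬ c • T ⊆ R).card ≤ ∑ t ∈ T, escape t R := by
  refine (Finset.card_le_card (t := T.biUnion fun t => R.filter fun x => x * t ∉ R) ?_).trans
    Finset.card_biUnion_le
  intro c hc
  rw [Finset.mem_filter, Finset.not_subset] at hc
  obtain ⟨hc, y, hy, hyR⟩ := hc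
  obtain ⟨t, ht, rfl⟩ := Finset.mem_smul_finset.1 hy
  exact Finset.mem_biUnion.2 ⟨t, ht, Finset.mem_filter.2 ⟨hc, hyR⟩⟩

/-- Double counting of incidences: a point lies in `c • T` for at most `|T|` centers `c`. -/
theorem card_mul_le_of_forall_lt_inter {ε : ℝ} {T : Finset Γ} (hT : T.Nonempty) (I U : Finset Γ)
    (h : ∀ c ∈ I, ε * T.card < ((c • T) ∩ U).card) : ε * I.card ≤ U.card := by
  have hTpos : (0 : ℝ) < T.card := by exact_mod_cast hT.card_pos
  have h1 : ∑ c ∈ I, ((c • T) ∩ U).card ≤ U.card * T.card := by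
    have h2 := Finset.sum_card_bipartiteAbove_eq_sum_card_bipartiteBelow
      (s := I) (t := U) (fun c x => x ∈ c • T)
    have h3 : ∀ c ∈ I, ((c • T) ∩ U).card = (Finset.bipartiteAbove (fun c x => x ∈ c • T) U c).card := by
      intro c _
      congr 1
      ext x
      simp [Finset.bipartiteAbove, and_comm]
    rw [Finset.sum_congr rfl h3, h2]
    refine Finset.sum_le_card_nsmul _ _ _ fun x _ => ?_
    refine Finset.card_le_card_of_injOn (fun c => c⁻¹ * x) ?_ fun c _ d _ h => by simpa using h
    intro c hc
    simp only [Finset.bipartiteBelow, Finset.coe_filter, Set.mem_ofPred_eq] at hc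
    simpa [← Finset.inv_smul_mem_iff] using hc.2
  have h4 : (I.card : ℝ) * (ε * T.card) ≤ ∑ c ∈ I, (((c • T) ∩ U).card : ℝ) := by
    rw [← nsmul_eq_mul]
    exact Finset.card_nsmul_le_sum _ _ _ fun c hc => (h c hc).le
  have h5 : ∑ c ∈ I, (((c • T) ∩ U).card : ℝ) ≤ U.card * T.card := by exact_mod_cast h1
  refine le_of_mul_le_mul_right ?_ hTpos
  linarith

/-- Disjoint subsets of `R`, each of which is a large part of a translate of a member of the
family `𝒯`. -/
structure IsQuasiTiling (ε : ℝ) (𝒯 : Finset (Finset Γ)) (R : Finset Γ)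
    (P : Finset (Finset Γ)) : Prop where
  disjoint : (P : Set (Finset Γ)).PairwiseDisjoint id
  piece : ∀ A ∈ P, ∃ T ∈ 𝒯, ∃ c : Γ, A ⊆ c • T ∧ (1 - ε) * T.card ≤ A.card
  subset : P.biUnion id ⊆ R

/-- Each round packs with one new tile and covers at least the fraction `ε / 2` of what is left. The
boundary is measured against a fixed scale `M`, because the remainders shrink while their boundaries
do not; the process stops once at most `ε * M` points remain. The induction adds the tile that is
used first, so that it can be made invariant enough for the later rounds. -/
theorem exists_quasiTiling_rounds {𝒞 : Finset Γ → Prop} (h𝒞 : ∃ᶠ F in folnerFilter Γ, 𝒞 F)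
    {ε : ℝ} (hε : 0 < ε) (hε' : ε ≤ 1 / 2) (N : ℕ) :
    ∃ 𝒯 : Finset (Finset Γ), (∀ T ∈ 𝒯, 𝒞 T ∧ T.Nonempty) ∧
      ∃ B : Finset Γ, ∃ δ : ℝ, 0 < δ ∧ ∀ (R : Finset Γ) (M : ℝ), (R.card : ℝ) ≤ M →
        (∑ b ∈ B, (escape b R : ℝ)) ≤ δ * M →
        ∃ P, IsQuasiTiling ε 𝒯 R P ∧
          ((R \ P.biUnion id).card : ℝ) ≤ max (ε * M) ((1 - ε / 2) ^ N * R.card) := by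
  induction N with
  | zero =>
    refine ⟨∅, by simp, ∅, 1, one_pos, fun R M _ _ => ⟨∅, ⟨by simp, by simp, by simp⟩, ?_⟩⟩
    simp
  | succ N ih =>
    obtain ⟨𝒯, h𝒯, B, δ, hδ, H⟩ := ih
    -- A frequent property suffices, since only one tile is chosen per round. Removing the packing
    -- adds a boundary of at most `|P| * (δ / 4) * |T|`, and `|P| * |T| ≤ 2 * |R|` because `ε ≤ 1 /
    -- 2`; this uses the half of the allowance `δ * M` not consumed by `R`.
    obtain ⟨T, hTC, hTne, hTB⟩ := (h𝒞.and_eventually (eventually_folner_nonempty.and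
      (eventually_sum_escape_le B (δ := δ / 4) (by positivity)))).exists
    refine ⟨insert T 𝒯, ?_, B ∪ T, min (δ / 2) (ε / 2), by positivity, ?_⟩
    · intro T' hT'
      rcases Finset.mem_insert.1 hT' with rfl | h
      exacts [⟨hTC, hTne⟩, h𝒯 _ h]
    intro R M hRM hR
    have hM : 0 ≤ M := (Nat.cast_nonneg _).trans hRM
    by_cases hsmall : (R.card : ℝ) ≤ ε * M
    · exact ⟨∅, ⟨by simp, by simp, by simp⟩, by simpa using Or.inl hsmall⟩
    push Not at hsmall
    have hRB : (∑ b ∈ B, (escape b R : ℝ)) ≤ δ / 2 * M :=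
      (Finset.sum_le_sum_of_subset_of_nonneg Finset.subset_union_left
        fun _ _ _ => Nat.cast_nonneg _).trans (hR.trans (by gcongr; exact min_le_left _ _))
    have hRT : (∑ b ∈ T, (escape b R : ℝ)) ≤ ε / 2 * M :=
      (Finset.sum_le_sum_of_subset_of_nonneg Finset.subset_union_right
        fun _ _ _ => Nat.cast_nonneg _).trans (hR.trans (by gcongr; exact min_le_right _ _))
    obtain ⟨P, hP, hPmax⟩ := exists_isPacking_maximal (ε := ε) (by linarith) hTne R
    set U := P.biUnion id with hU
    -- Since `ε * M < |R|`, the at most `ε / 2 * M` bad centers make up less than half of `R`.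
    have hI : (R.card : ℝ) / 2 ≤ (R.filter fun c => c • T ⊆ R).card := by
      have h1 : ((R.filter fun c => c • T ⊆ R).card : ℝ) +
          (R.filter fun c => ¬ c • T ⊆ R).card = R.card := by
        exact_mod_cast Finset.card_filter_add_card_filter_not _
      have h2 : ((R.filter fun c => ¬ c • T ⊆ R).card : ℝ) ≤ ∑ t ∈ T, (escape t R : ℝ) := by
        exact_mod_cast card_filter_not_smul_subset_le T R
      linarith
    have hUcard : ε * (R.filter fun c => c • T ⊆ R).card ≤ U.card :=
      card_mul_le_of_forall_lt_inter hTne _ _ fun c hc => hPmax c (Finset.mem_filter.1 hc).2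
    have hR1 : ((R \ U).card : ℝ) = R.card - U.card := by
      rw [Finset.card_sdiff_of_subset hP.subset, Nat.cast_sub (Finset.card_le_card hP.subset)]
    have hR1' : ((R \ U).card : ℝ) ≤ (1 - ε / 2) * R.card := by
      rw [hR1]; nlinarith
    have hPT : (P.card : ℝ) * T.card ≤ 2 * R.card := by
      have h1 := hP.card_mul_le
      have h2 : (P.card : ℝ) * T.card * (1 / 2) ≤ P.card * T.card * (1 - ε) := by
        gcongr; linarith
      linarith
    have hR1B : (∑ b ∈ B, (escape b (R \ U) : ℝ)) ≤ δ * M := by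
      have h1 : (∑ b ∈ B, (escape b (R \ U) : ℝ)) ≤
          ∑ b ∈ B, ((escape b R : ℝ) + P.card * escape b T) :=
        Finset.sum_le_sum fun b _ => by exact_mod_cast hP.escape_sdiff_le b
      rw [Finset.sum_add_distrib, ← Finset.mul_sum] at h1
      have h2 : (P.card : ℝ) * ∑ b ∈ B, (escape b T : ℝ) ≤ P.card * (δ / 4 * T.card) := by
        gcongr
      have h3 : (P.card : ℝ) * (δ / 4 * T.card) ≤ δ / 4 * (2 * M) := by
        calc (P.card : ℝ) * (δ / 4 * T.card) = δ / 4 * (P.card * T.card) := by ring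
          _ ≤ δ / 4 * (2 * R.card) := by gcongr
          _ ≤ δ / 4 * (2 * M) := by gcongr
      linarith
    obtain ⟨Q, hQ, hQcard⟩ := H (R \ U) M (by
      refine le_trans ?_ hRM
      exact_mod_cast Finset.card_le_card Finset.sdiff_subset) hR1B
    have hunion : (P ∪ Q).biUnion id = U ∪ Q.biUnion id := by
      rw [Finset.union_biUnion]
    refine ⟨P ∪ Q, ⟨?_, ?_, ?_⟩, ?_⟩
    · rw [Finset.coe_union, Set.pairwiseDisjoint_union]
      refine ⟨hP.disjoint, hQ.disjoint, fun A hA A' hA' _ => ?_⟩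
      exact Finset.disjoint_sdiff.mono (Finset.subset_biUnion_of_mem id hA)
        ((Finset.subset_biUnion_of_mem id hA').trans hQ.subset)
    · intro A hA
      rcases Finset.mem_union.1 hA with hA | hA
      · obtain ⟨c, h1, -, h2⟩ := hP.piece A hA
        exact ⟨T, Finset.mem_insert_self _ _, c, h1, h2⟩
      · obtain ⟨T', hT', c, h⟩ := hQ.piece A hA
        exact ⟨T', Finset.mem_insert_of_mem hT', c, h⟩
    · rw [hunion]
      exact Finset.union_subset hP.subset (hQ.subset.trans Finset.sdiff_subset)
    · have he : R \ (U ∪ Q.biUnion id) = (R \ U) \ Q.biUnion id := by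
        ext x; simp only [Finset.mem_union, Finset.mem_sdiff]; tauto
      rw [hunion, he]
      refine hQcard.trans (max_le_max le_rfl ?_)
      rw [pow_succ, mul_assoc]
      have : 0 ≤ 1 - ε / 2 := by linarith
      gcongr

theorem exists_quasiTiling {𝒞 : Finset Γ → Prop} (h𝒞 : ∃ᶠ F in folnerFilter Γ, 𝒞 F)
    {ε : ℝ} (hε : 0 < ε) (hε' : ε ≤ 1 / 2) :
    ∃ 𝒯 : Finset (Finset Γ), (∀ T ∈ 𝒯, 𝒞 T ∧ T.Nonempty) ∧ ∀ᶠ F in folnerFilter Γ,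
      ∃ P, IsQuasiTiling ε 𝒯 F P ∧ ((F \ P.biUnion id).card : ℝ) ≤ ε * F.card := by
  obtain ⟨N, hN⟩ := exists_pow_lt_of_lt_one hε (by linarith : 1 - ε / 2 < 1)
  obtain ⟨𝒯, h𝒯, B, δ, hδ, H⟩ := exists_quasiTiling_rounds h𝒞 hε hε' N
  refine ⟨𝒯, h𝒯, eventually_folner_iff.2 ⟨B, δ, hδ, fun F _ hF => ?_⟩⟩
  obtain ⟨P, hP, hcard⟩ := H F F.card le_rfl hF
  refine ⟨P, hP, hcard.trans (max_le le_rfl ?_)⟩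
  gcongr

end Quasitiling

/-! ### The Ornstein–Weiss lemma -/

section OrnsteinWeiss

open scoped Pointwise
open scoped Classical

variable {Γ : Type u} [Group Γ]

/-- A set function that is monotone, subadditive, invariant under left translations and bounded by
the cardinality. -/
structure IsInvariantSubadditive (h : Finset Γ → ℕ) : Prop where
  mono : ∀ A B, A ⊆ B → h A ≤ h B
  union_le : ∀ A B, h (A ∪ B) ≤ h A + h B
  smul : ∀ (c : Γ) A, h (c • A) = h A
  le_card : ∀ A, h A ≤ A.card

namespace IsInvariantSubadditive

variable {h : Finset Γ → ℕ}

theorem biUnion_le (hh : IsInvariantSubadditive h) (P : Finset (Finset Γ)) :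
    h (P.biUnion id) ≤ ∑ A ∈ P, h A := by
  induction P using Finset.induction_on with
  | empty => simpa using hh.le_card ∅
  | insert A P hA ih =>
    rw [Finset.biUnion_insert, Finset.sum_insert hA]
    exact (hh.union_le _ _).trans (Nat.add_le_add_left ih _)

/-- Quasi-tile `F` by sets with ratio below `a`. A piece satisfies `h A ≤ h T < a * |T| ≤ a / (1 -
ε) * |A|`, and the uncovered points cost at most `ε * |F|`. Thus the ratio cannot oscillate along
the filter. -/
theorem eventually_le (hh : IsInvariantSubadditive h) {a b : ℝ} (hab : a < b)
    (ha : ∃ᶠ F in folnerFilter Γ, (h F : ℝ) / F.card < a) :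
    ∀ᶠ F in folnerFilter Γ, (h F : ℝ) / F.card ≤ b := by
  have ha0 : 0 < a := by
    obtain ⟨F, hF⟩ := ha.exists
    exact lt_of_le_of_lt (by positivity) hF
  obtain ⟨ε, hε, hε2, hεb⟩ : ∃ ε : ℝ, 0 < ε ∧ ε ≤ 1 / 2 ∧ a / (1 - ε) + ε ≤ b := by
    have hc : Tendsto (fun ε : ℝ => a / (1 - ε) + ε) (𝓝 0) (𝓝 a) := by
      have : ContinuousAt (fun ε : ℝ => a / (1 - ε) + ε) 0 := by
        refine ContinuousAt.add (ContinuousAt.div continuousAt_const (by fun_prop) (by simp)) (by fun_prop)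
      simpa [ContinuousAt] using this
    have h1 : ∀ᶠ ε in 𝓝[>] (0 : ℝ), a / (1 - ε) + ε ≤ b :=
      nhdsWithin_le_nhds (hc.eventually_le_const hab)
    have h2 : ∀ᶠ ε in 𝓝[>] (0 : ℝ), ε ≤ 1 / 2 :=
      nhdsWithin_le_nhds (tendsto_id.eventually_le_const (by norm_num))
    obtain ⟨ε, h⟩ := (h1.and (h2.and self_mem_nhdsWithin)).exists
    exact ⟨ε, h.2.2, h.2.1, h.1⟩
  obtain ⟨𝒯, h𝒯, H⟩ := exists_quasiTiling ha hε hε2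
  filter_upwards [H, eventually_folner_nonempty] with F hF hFne
  obtain ⟨P, hP, hcard⟩ := hF
  have hFpos : (0 : ℝ) < F.card := by exact_mod_cast hFne.card_pos
  have h1ε : 0 < 1 - ε := by linarith
  rw [div_le_iff₀ hFpos]
  have hpiece : ∀ A ∈ P, (h A : ℝ) ≤ a / (1 - ε) * A.card := by
    intro A hA
    obtain ⟨T, hT, c, hAT, hTA⟩ := hP.piece A hA
    obtain ⟨hTa, hTne⟩ := h𝒯 T hT
    have hTpos : (0 : ℝ) < T.card := by exact_mod_cast hTne.card_pos
    rw [div_lt_iff₀ hTpos] at hTa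
    have h1 : (h A : ℝ) ≤ h T := by
      rw [← hh.smul c T]; exact_mod_cast hh.mono _ _ hAT
    calc (h A : ℝ) ≤ a * T.card := h1.trans hTa.le
      _ = a / (1 - ε) * ((1 - ε) * T.card) := by field_simp
      _ ≤ a / (1 - ε) * A.card := by gcongr
  have h2 : (h (P.biUnion id) : ℝ) ≤ a / (1 - ε) * F.card := by
    have e1 : (h (P.biUnion id) : ℝ) ≤ ∑ A ∈ P, (h A : ℝ) := by exact_mod_cast hh.biUnion_le P
    have e2 : ((P.biUnion id).card : ℝ) = ∑ A ∈ P, (A.card : ℝ) := by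
      rw [Finset.card_biUnion hP.disjoint]; push_cast; rfl
    calc (h (P.biUnion id) : ℝ) ≤ ∑ A ∈ P, a / (1 - ε) * (A.card : ℝ) :=
          e1.trans (Finset.sum_le_sum hpiece)
      _ = a / (1 - ε) * (P.biUnion id).card := by rw [e2, Finset.mul_sum]
      _ ≤ a / (1 - ε) * F.card := by
        gcongr
        exact hP.subset
  have h3 : (h F : ℝ) ≤ h (P.biUnion id) + (F \ P.biUnion id).card := by
    have e1 := hh.union_le (P.biUnion id) (F \ P.biUnion id)
    rw [Finset.union_sdiff_of_subset hP.subset] at e1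
    exact_mod_cast e1.trans (Nat.add_le_add_left (hh.le_card _) _)
  calc (h F : ℝ) ≤ (a / (1 - ε) + ε) * F.card := by linarith
    _ ≤ b * F.card := by gcongr

/-- The Ornstein–Weiss lemma. -/
theorem exists_tendsto (hh : IsInvariantSubadditive h) :
    ∃ r : ℝ, Tendsto (fun F => (h F : ℝ) / F.card) (folnerFilter Γ) (𝓝 r) := by
  refine tendsto_of_no_upcrossings (s := Set.univ) dense_univ ?_ ?_ ?_
  · rintro a - b - hab ⟨h1, h2⟩
    refine h2 ?_
    filter_upwards [hh.eventually_le hab h1] with F hF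
    exact not_lt.2 hF
  · refine isBoundedUnder_of ⟨1, fun F => div_le_one_of_le₀ ?_ (Nat.cast_nonneg _)⟩
    exact_mod_cast hh.le_card F
  · exact isBoundedUnder_of ⟨0, fun F => by positivity⟩

end IsInvariantSubadditive

/-! ### Følner sequences -/

theorem escape_le_card_cayleyBoundary {S : Finset Γ} {s : Γ} (hs : s ∈ S) (F : Finset Γ) :
    escape s F ≤ (cayleyBoundary S F).card := by
  refine Finset.card_le_card fun x hx => ?_
  rw [Finset.mem_filter] at hx
  exact Finset.mem_filter.2 ⟨hx.1, s, hs, hx.2⟩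

/-- The boundary controls the generators, and `escape` is subadditive under products and does not
increase under inversion. -/
theorem IsFolnerSequence.tendsto_escape {S : Finset Γ} (hS : IsSymmetricGenerating S)
    {F : ℕ → Finset Γ} (hF : IsFolnerSequence S F) (b : Γ) :
    Tendsto (fun n => (escape b (F n) : ℝ) / (F n).card) atTop (𝓝 0) := by
  have hb : b ∈ Subgroup.closure (S : Set Γ) := hS.2 ▸ Subgroup.mem_top b
  induction hb using Subgroup.closure_induction with
  | mem s hs =>
    refine squeeze_zero (fun n => by positivity) (fun n => ?_) hF.2
    have := escape_le_card_cayleyBoundary (Finset.mem_coe.1 hs) (F n)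
    gcongr
  | one => simp [escape_one]
  | mul b c _ _ hb hc =>
    refine squeeze_zero (fun n => by positivity) (fun n => ?_) (by simpa using hb.add hc)
    rw [← add_div]
    have : (escape (b * c) (F n) : ℝ) ≤ escape b (F n) + escape c (F n) := by
      exact_mod_cast escape_mul_le b c (F n)
    gcongr
  | inv b _ hb =>
    refine squeeze_zero (fun n => by positivity) (fun n => ?_) hb
    have := escape_inv_le b (F n)
    gcongr

theorem IsFolnerSequence.tendsto_folnerFilter {S : Finset Γ} (hS : IsSymmetricGenerating S)
    {F : ℕ → Finset Γ} (hF : IsFolnerSequence S F) : Tendsto F atTop (folnerFilter Γ) := by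
  intro W hW
  obtain ⟨B, δ, hδ, H⟩ := hW
  have h1 : Tendsto (fun n => ∑ b ∈ B, (escape b (F n) : ℝ) / (F n).card) atTop (𝓝 0) := by
    simpa using tendsto_finsetSum B fun b _ => hF.tendsto_escape hS b
  rw [Filter.mem_map]
  filter_upwards [Tendsto.eventually_le_const hδ h1] with n hn
  refine H _ (hF.1 n) ?_
  have hpos : (0 : ℝ) < (F n).card := by exact_mod_cast (hF.1 n).card_pos
  rwa [← Finset.sum_div, div_le_iff₀ hpos] at hn

theorem IsAmenableGroup.neBot (h : IsAmenableGroup Γ) : (folnerFilter Γ).NeBot := by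
  obtain ⟨S, hS, F, hF⟩ := h
  exact (hF.tendsto_folnerFilter hS).neBot

/-! ### Exact tilings -/

/-- The shape of a tile: a member of the family `𝒯`, or a single point. -/
def tileShape (𝒯 : Finset (Finset Γ)) : Option 𝒯 → Finset Γ
  | none => {1}
  | some T => T

/-- The translates `c • tileShape 𝒯 t` for `c ∈ C t` partition `F`. -/
structure IsTiling (𝒯 : Finset (Finset Γ)) (C : Option 𝒯 → Finset Γ) (F : Finset Γ) : Prop where
  mem : ∀ t, ∀ c ∈ C t, ∀ y ∈ tileShape 𝒯 t, c * y ∈ F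
  cover : ∀ x ∈ F, ∃ t, ∃ c ∈ C t, c⁻¹ * x ∈ tileShape 𝒯 t
  unique : ∀ x t t' c c', c ∈ C t → c' ∈ C t' → c⁻¹ * x ∈ tileShape 𝒯 t →
    c'⁻¹ * x ∈ tileShape 𝒯 t' → t = t' ∧ c = c'

/-- `F` is tiled by members of `𝒯`, except for at most `ε * |F|` points. -/
def IsTiledBy (ε : ℝ) (𝒯 : Finset (Finset Γ)) (F : Finset Γ) : Prop :=
  ∃ C : Option 𝒯 → Finset Γ, IsTiling 𝒯 C F ∧ ((C none).card : ℝ) ≤ ε * F.card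

theorem isTiledBy_of_disjoint {ε : ℝ} {𝒯 : Finset (Finset Γ)} {F : Finset Γ}
    {P : Finset (Finset Γ)} (hd : (P : Set (Finset Γ)).PairwiseDisjoint id)
    (hp : ∀ A ∈ P, ∃ T ∈ 𝒯, ∃ c : Γ, A = c • T) (hs : P.biUnion id ⊆ F)
    (hc : ((F \ P.biUnion id).card : ℝ) ≤ ε * F.card) :
    IsTiledBy ε 𝒯 F := by
  choose! τ hτ γ hγ using hp
  let C : Option 𝒯 → Finset Γ
    | none => F \ P.biUnion id
    | some T => (P.filter fun A => τ A = T).image γ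
  have hC : ∀ T c, c ∈ C (some T) → c • (T : Finset Γ) ∈ P ∧ τ (c • (T : Finset Γ)) = T ∧
      γ (c • (T : Finset Γ)) = c := by
    intro T c hc
    obtain ⟨A, hA, rfl⟩ := Finset.mem_image.1 hc
    rw [Finset.mem_filter] at hA
    have h := hγ A hA.1
    rw [hA.2] at h
    rw [← h]
    exact ⟨hA.1, hA.2, rfl⟩
  have hsome : ∀ T c x, c ∈ C (some T) → c⁻¹ * x ∈ tileShape 𝒯 (some T) →
      x ∈ c • (T : Finset Γ) := by
    intro T c x _ hx
    rwa [← Finset.inv_smul_mem_iff]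
  have hnone : ∀ c x : Γ, c⁻¹ * x ∈ tileShape 𝒯 none → c = x := by
    intro c x hx
    rw [tileShape, Finset.mem_singleton] at hx
    exact inv_mul_eq_one.1 hx
  refine ⟨C, ⟨?_, ?_, ?_⟩, hc⟩
  · rintro (_ | T) c hc y hy
    · rw [tileShape, Finset.mem_singleton] at hy
      rw [hy, mul_one]
      exact (Finset.mem_sdiff.1 hc).1
    · exact hs (Finset.mem_biUnion.2 ⟨_, (hC T c hc).1, Finset.smul_mem_smul_finset hy⟩)
  · intro x hx
    by_cases hxP : x ∈ P.biUnion id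
    · obtain ⟨A, hA, hxA⟩ := Finset.mem_biUnion.1 hxP
      refine ⟨some ⟨τ A, hτ A hA⟩, γ A, ?_, ?_⟩
      · exact Finset.mem_image.2 ⟨A, Finset.mem_filter.2 ⟨hA, rfl⟩, rfl⟩
      · change (γ A)⁻¹ • x ∈ τ A
        rw [Finset.inv_smul_mem_iff, ← hγ A hA]
        exact hxA
    · exact ⟨none, x, Finset.mem_sdiff.2 ⟨hx, hxP⟩, by simp [tileShape]⟩
  · rintro x (_ | T) (_ | T') c c' hc hc' hx hx'
    · rw [hnone _ _ hx, hnone _ _ hx']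
      exact ⟨rfl, rfl⟩
    · rw [hnone _ _ hx] at hc
      exact absurd (Finset.mem_biUnion.2 ⟨_, (hC T' c' hc').1, hsome T' c' x hc' hx'⟩)
        (Finset.mem_sdiff.1 hc).2
    · rw [hnone _ _ hx'] at hc'
      exact absurd (Finset.mem_biUnion.2 ⟨_, (hC T c hc).1, hsome T c x hc hx⟩)
        (Finset.mem_sdiff.1 hc').2
    · have e : c • (T : Finset Γ) = c' • (T' : Finset Γ) :=
        hd.elim_finset (hC T c hc).1 (hC T' c' hc').1 x (hsome T c x hc hx) (hsome T' c' x hc' hx')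
      have e1 := (hC T c hc).2
      have e2 := (hC T' c' hc').2
      rw [e] at e1
      exact ⟨by rw [Option.some_inj]; exact Subtype.ext (e1.1.symm.trans e2.1),
        e1.2.symm.trans e2.2⟩

/-- A piece of a quasi-tiling is a trimmed translate. All sufficiently large subsets of the tiles
are therefore taken as new tiles: there are finitely many, and trimming preserves the almost
invariance that forces `W`. -/
theorem exists_isTiledBy [(folnerFilter Γ).NeBot] {W : Finset Γ → Prop}
    (hW : ∀ᶠ F in folnerFilter Γ, W F) {ε : ℝ} (hε : 0 < ε) :
    ∃ 𝒯 : Finset (Finset Γ), (∀ T ∈ 𝒯, W T ∧ T.Nonempty) ∧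
      ∀ᶠ F in folnerFilter Γ, IsTiledBy ε 𝒯 F := by
  obtain ⟨B, δ, hδ, hW⟩ := eventually_folner_iff.1 hW
  -- The bounds `η ≤ 1 / 2` and `|B| * η ≤ δ / 4` give a trimmed tile a boundary of at most `δ / 2 *
  -- |T| ≤ δ * |A|`. The `+ 1` covers the case of empty `B`.
  set η : ℝ := min ε (min (1 / 2) (δ / (4 * (B.card + 1)))) with hη
  have hη0 : 0 < η := by positivity
  have hη1 : η ≤ 1 / 2 := (min_le_right _ _).trans (min_le_left _ _)
  have hη2 : B.card * η ≤ δ / 4 := by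
    have h1 : η ≤ δ / (4 * (B.card + 1)) := (min_le_right _ _).trans (min_le_right _ _)
    rw [le_div_iff₀ (by positivity)] at h1
    nlinarith
  obtain ⟨𝒯, h𝒯, H⟩ := exists_quasiTiling
    (eventually_sum_escape_le B (δ := δ / 4) (by positivity)).frequently hη0 hη1
  have htrim : ∀ T ∈ 𝒯, ∀ A ⊆ T, (1 - η) * T.card ≤ (A.card : ℝ) → W A ∧ A.Nonempty := by
    intro T hT A hAT hA
    obtain ⟨hTB, hTne⟩ := h𝒯 T hT
    have hTpos : (0 : ℝ) < T.card := by exact_mod_cast hTne.card_pos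
    have hA2 : (T.card : ℝ) / 2 ≤ A.card := le_trans (by nlinarith) hA
    have hAne : A.Nonempty := by
      rw [← Finset.card_pos]
      have : (0 : ℝ) < A.card := by linarith
      exact_mod_cast this
    refine ⟨hW A hAne ?_, hAne⟩
    have hdiff : ((T \ A).card : ℝ) ≤ η * T.card := by
      rw [Finset.card_sdiff_of_subset hAT, Nat.cast_sub (Finset.card_le_card hAT)]
      linarith
    calc (∑ b ∈ B, (escape b A : ℝ)) ≤ ∑ b ∈ B, ((escape b T : ℝ) + (T \ A).card) :=
          Finset.sum_le_sum fun b _ => by exact_mod_cast escape_trim_le b hAT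
      _ = (∑ b ∈ B, (escape b T : ℝ)) + B.card * (T \ A).card := by
          rw [Finset.sum_add_distrib, Finset.sum_const, nsmul_eq_mul]
      _ ≤ δ / 4 * T.card + B.card * (η * T.card) := by gcongr
      _ ≤ δ / 4 * T.card + δ / 4 * T.card := by
          rw [← mul_assoc]; gcongr
      _ ≤ δ * A.card := by nlinarith
  set 𝒯' : Finset (Finset Γ) := 𝒯.biUnion fun T =>
    T.powerset.filter fun A => (1 - η) * T.card ≤ (A.card : ℝ) with h𝒯'
  have hmem : ∀ A ∈ 𝒯', ∃ T ∈ 𝒯, A ⊆ T ∧ (1 - η) * T.card ≤ (A.card : ℝ) := by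
    intro A hA
    obtain ⟨T, hT, hA⟩ := Finset.mem_biUnion.1 hA
    rw [Finset.mem_filter, Finset.mem_powerset] at hA
    exact ⟨T, hT, hA⟩
  have hW' : ∀ A ∈ 𝒯', W A ∧ A.Nonempty := by
    intro A hA
    obtain ⟨T, hT, h1, h2⟩ := hmem A hA
    exact htrim T hT A h1 h2
  refine ⟨𝒯', hW', ?_⟩
  filter_upwards [H] with F hF
  obtain ⟨P, hP, hcard⟩ := hF
  refine isTiledBy_of_disjoint hP.disjoint ?_ hP.subset ?_
  · intro A hA
    obtain ⟨T, hT, c, h1, h2⟩ := hP.piece A hA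
    refine ⟨c⁻¹ • A, ?_, c, (smul_inv_smul c A).symm⟩
    refine Finset.mem_biUnion.2 ⟨T, hT, Finset.mem_filter.2 ⟨Finset.mem_powerset.2 ?_, ?_⟩⟩
    · rwa [← Finset.subset_smul_finset_iff]
    · rwa [Finset.card_smul_finset]
  · refine hcard.trans ?_
    gcongr
    exact min_le_left _ _

/-- With no proper tiles every point would be a singleton. A proper tile is needed at each level to
carry the initial mass of the harmonic weight. -/
theorem IsTiledBy.nonempty {ε : ℝ} (hε : ε < 1) {𝒯 : Finset (Finset Γ)} {F : Finset Γ}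
    (hF : F.Nonempty) (h : IsTiledBy ε 𝒯 F) : 𝒯.Nonempty := by
  by_contra hne
  rw [Finset.not_nonempty_iff_eq_empty] at hne
  obtain ⟨C, hC, hcard⟩ := h
  have hsub : F ⊆ C none := by
    intro x hx
    obtain ⟨_ | T, c, hc, hcx⟩ := hC.cover x hx
    · rw [tileShape, Finset.mem_singleton] at hcx
      rwa [← inv_mul_eq_one.1 hcx]
    · exact absurd T.2 (by simp [hne])
  have h1 : (F.card : ℝ) ≤ (C none).card := by exact_mod_cast Finset.card_le_card hsub
  have h2 : (0 : ℝ) < F.card := by exact_mod_cast hF.card_pos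
  nlinarith

theorem exists_tile_sequence [(folnerFilter Γ).NeBot] {W : ℕ → Finset Γ → Prop}
    (hW : ∀ n, ∀ᶠ F in folnerFilter Γ, W n F) {ε : ℕ → ℝ} (hε : ∀ n, 0 < ε n)
    (hε' : ∀ n, ε n < 1) :
    ∃ 𝒯 : ℕ → Finset (Finset Γ), (∀ n, (𝒯 n).Nonempty) ∧
      (∀ n, ∀ T ∈ 𝒯 n, W n T ∧ T.Nonempty) ∧
      ∀ n, ∀ F ∈ 𝒯 (n + 1), IsTiledBy (ε n) (𝒯 n) F := by
  -- The recursion carries along that almost every set is tiled by the current family; the next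
  -- family is then chosen among such sets.
  let Q : ℕ → Finset (Finset Γ) → Prop := fun n 𝒯 => 𝒯.Nonempty ∧
    (∀ T ∈ 𝒯, W n T ∧ T.Nonempty) ∧ ∀ᶠ F in folnerFilter Γ, IsTiledBy (ε n) 𝒯 F
  have hQ : ∀ n (p : Finset Γ → Prop), (∀ᶠ F in folnerFilter Γ, p F) →
      ∃ 𝒯, Q n 𝒯 ∧ ∀ T ∈ 𝒯, p T := by
    intro n p hp
    obtain ⟨𝒯, h1, h2⟩ := exists_isTiledBy ((hW n).and hp) (hε n)
    obtain ⟨F, hF, hFne⟩ := (h2.and eventually_folner_nonempty).exists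
    exact ⟨𝒯, ⟨hF.nonempty (hε' n) hFne, fun T hT => ⟨(h1 T hT).1.1, (h1 T hT).2⟩, h2⟩,
      fun T hT => (h1 T hT).1.2⟩
  have hstep : ∀ n (𝒯 : {𝒯 // Q n 𝒯}), ∃ 𝒯' : {𝒯' // Q (n + 1) 𝒯'},
      ∀ F ∈ 𝒯'.1, IsTiledBy (ε n) 𝒯.1 F := by
    rintro n ⟨𝒯, h𝒯⟩
    obtain ⟨𝒯', h1, h2⟩ := hQ (n + 1) _ h𝒯.2.2
    exact ⟨⟨𝒯', h1⟩, h2⟩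
  choose next hnext using hstep
  obtain ⟨𝒯₀, h₀, -⟩ := hQ 0 (fun _ => True) (Eventually.of_forall fun _ => trivial)
  let seq : ∀ n, {𝒯 // Q n 𝒯} := fun n => Nat.rec ⟨𝒯₀, h₀⟩ next n
  exact ⟨fun n => (seq n).1, fun n => (seq n).2.1, fun n => (seq n).2.2.1,
    fun n => hnext n (seq n)⟩

end OrnsteinWeiss

/-! ### Ranks in the group algebra -/

section GroupAlgebraRank

open scoped Pointwise
open scoped Classical

variable {Γ : Type u} [Group Γ] {K : Type v} [Field K]

theorem rank_le_card_of_row_eq_zero {m n : Type*} [Fintype m] [Fintype n] (A : Matrix m n K)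
    (S : Finset m) (h : ∀ i, A i ≠ 0 → i ∈ S) : A.rank ≤ S.card := by
  rw [A.rank_eq_finrank_span_row]
  have h1 : Submodule.span K (Set.range A.row) ≤ Submodule.span K (S.image A.row : Finset (n → K)) := by
    rw [Submodule.span_le]
    rintro _ ⟨i, rfl⟩
    by_cases hi : A i = 0
    · have : A.row i = 0 := hi
      rw [this]
      exact Submodule.zero_mem _
    · exact Submodule.subset_span (Finset.mem_coe.2 (Finset.mem_image_of_mem _ (h i hi)))
  exact (Submodule.finrank_mono h1).trans
    ((finrank_span_finset_le_card _).trans Finset.card_image_le)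

/-- The span of the left translates of `a` by the elements of `F`. -/
noncomputable def translateSpan (a : MonoidAlgebra K Γ) (F : Finset Γ) : Submodule K (MonoidAlgebra K Γ) :=
  Submodule.span K (F.image fun x => MonoidAlgebra.single x 1 * a : Finset (MonoidAlgebra K Γ))

instance (a : MonoidAlgebra K Γ) (F : Finset Γ) : FiniteDimensional K (translateSpan a F) :=
  FiniteDimensional.span_finset K _

theorem single_mul_mem_translateSpan (a : MonoidAlgebra K Γ) {F : Finset Γ} {x : Γ} (hx : x ∈ F) :
    MonoidAlgebra.single x 1 * a ∈ translateSpan a F :=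
  Submodule.subset_span (Finset.mem_coe.2 (Finset.mem_image_of_mem _ hx))

theorem translateSpan_le {a : MonoidAlgebra K Γ} {F : Finset Γ}
    {p : Submodule K (MonoidAlgebra K Γ)} :
    translateSpan a F ≤ p ↔ ∀ x ∈ F, MonoidAlgebra.single x 1 * a ∈ p := by
  simp [translateSpan, Submodule.span_le, Set.subset_def]

theorem coeff_translate (a : MonoidAlgebra K Γ) (x y : Γ) :
    (MonoidAlgebra.single x 1 * a).coeff y = a.coeff (x⁻¹ * y) := by
  rw [MonoidAlgebra.coeff_single_mul_apply, one_mul]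

theorem isInvariantSubadditive_finrank_translateSpan (a : MonoidAlgebra K Γ) :
    IsInvariantSubadditive fun F => Module.finrank K (translateSpan a F) where
  mono A B h := Submodule.finrank_mono
    (translateSpan_le.2 fun x hx => single_mul_mem_translateSpan a (h hx))
  union_le A B := by
    refine le_trans (Submodule.finrank_mono (t := translateSpan a A ⊔ translateSpan a B) ?_)
      (Submodule.finrank_add_le_finrank_add_finrank _ _)
    refine translateSpan_le.2 fun x hx => ?_
    rcases Finset.mem_union.1 hx with h | h
    · exact Submodule.mem_sup_left (single_mul_mem_translateSpan a h)
    · exact Submodule.mem_sup_right (single_mul_mem_translateSpan a h)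
  smul c A := by
    have key : ∀ (c : Γ) (A : Finset Γ),
        Module.finrank K (translateSpan a (c • A)) ≤ Module.finrank K (translateSpan a A) := by
      intro c A
      have h : translateSpan a (c • A) ≤
          (translateSpan a A).map (LinearMap.mulLeft K (MonoidAlgebra.single c 1)) := by
        refine translateSpan_le.2 fun x hx => ?_
        obtain ⟨y, hy, rfl⟩ := Finset.mem_smul_finset.1 hx
        refine ⟨_, single_mul_mem_translateSpan a hy, ?_⟩
        rw [LinearMap.mulLeft_apply, ← mul_assoc, MonoidAlgebra.single_mul_single, one_mul]
        rfl
      exact (Submodule.finrank_mono h).trans (Submodule.finrank_map_le _ _)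
    refine le_antisymm (key c A) ?_
    have h := key c⁻¹ (c • A)
    rwa [inv_smul_smul] at h
  le_card A := (finrank_span_finset_le_card _).trans Finset.card_image_le

/-- Rank–nullity for `z ↦ z * a` on the elements supported on `F`; it turns the annihilator
dimension into a subadditive quantity. -/
theorem finrank_translateSpan_add_annihilatorOn (a : MonoidAlgebra K Γ) (F : Finset Γ) :
    Module.finrank K (translateSpan a F) + Module.finrank K (annihilatorOn F a) = F.card := by
  let J : (F → K) →ₗ[K] MonoidAlgebra K Γ :=
    Fintype.linearCombination K fun x : F => MonoidAlgebra.single (x : Γ) (1 : K)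
  let L : (F → K) →ₗ[K] MonoidAlgebra K Γ :=
    Fintype.linearCombination K fun x : F => MonoidAlgebra.single (x : Γ) (1 : K) * a
  have hJL : ∀ z, J z * a = L z := by
    intro z
    simp only [J, L, Fintype.linearCombination_apply, Finset.sum_mul, smul_mul_assoc]
  have hJF : ∀ z (x : F), (J z).coeff x = z x := by
    intro z x
    simp only [J, Fintype.linearCombination_apply, MonoidAlgebra.coeff_sum,
      MonoidAlgebra.coeff_smul, MonoidAlgebra.coeff_single, Finsupp.finsetSum_apply,
      Finsupp.smul_apply, smul_eq_mul]
    rw [Finset.sum_eq_single x]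
    · simp
    · intro y _ hy
      rw [Finsupp.single_eq_of_ne (fun h => hy (Subtype.ext h.symm)), mul_zero]
    · simp
  have hJF' : ∀ z, ∀ γ ∉ F, (J z).coeff γ = 0 := by
    intro z γ hγ
    simp only [J, Fintype.linearCombination_apply, MonoidAlgebra.coeff_sum,
      MonoidAlgebra.coeff_smul, MonoidAlgebra.coeff_single, Finsupp.finsetSum_apply,
      Finsupp.smul_apply, smul_eq_mul]
    refine Finset.sum_eq_zero fun y _ => ?_
    rw [Finsupp.single_eq_of_ne (fun h : γ = y => hγ (h ▸ y.2)), mul_zero]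
  have hJinj : Function.Injective J := by
    intro z w h
    funext x
    rw [← hJF z x, ← hJF w x, h]
  have hker : annihilatorOn F a = (LinearMap.ker L).map J := by
    ext z
    constructor
    · rintro ⟨h1, h2⟩
      have hz : J (fun x => z.coeff x) = z := by
        ext γ
        by_cases hγ : γ ∈ F
        · exact hJF _ ⟨γ, hγ⟩
        · rw [hJF' _ γ hγ, h1 γ hγ]
      exact ⟨_, by rw [SetLike.mem_coe, LinearMap.mem_ker, ← hJL, hz, h2], hz⟩
    · rintro ⟨w, hw, rfl⟩
      exact ⟨hJF' w, by rw [hJL]; exact hw⟩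
  have hrange : translateSpan a F = LinearMap.range L := by
    rw [Fintype.range_linearCombination, translateSpan]
    congr 1
    ext z
    simp
  rw [hker, hrange, (Submodule.equivMapOfInjective J hJinj _).finrank_eq.symm,
    LinearMap.finrank_range_add_finrank_ker, Module.finrank_fintype_fun_eq_card, Fintype.card_coe]

/-- Choose a basis among the translates of `a`. The span is supported on the union `U` of the
supports of the basis elements, and `U` contains `x * s` for every `x ∈ F`, where `s` is a fixed
point of the support of `a`. -/
theorem card_le_card_support_mul_finrank_translateSpan {a : MonoidAlgebra K Γ} (ha : a ≠ 0)
    (F : Finset Γ) :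
    F.card ≤ Module.finrank K (translateSpan a F) * a.coeff.support.card := by
  obtain ⟨s, hs⟩ : a.coeff.support.Nonempty := by
    rw [Finsupp.support_nonempty_iff]
    simpa using ha
  obtain ⟨t, hts, htcard, htspan, -⟩ := Submodule.exists_finset_span_eq_linearIndepOn K
    ((F.image fun x => MonoidAlgebra.single x 1 * a : Finset (MonoidAlgebra K Γ)) :
      Set (MonoidAlgebra K Γ))
  have ht : ∀ z ∈ t, ∃ x ∈ F, MonoidAlgebra.single x 1 * a = z := by
    intro z hz
    simpa using hts hz
  choose! ξ hξ using ht
  set U : Finset Γ := t.biUnion fun z => ξ z • a.coeff.support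
  have hsupp : translateSpan a F ≤ MonoidAlgebra.supported K K (U : Set Γ) := by
    rw [translateSpan, ← htspan, Submodule.span_le]
    intro z hz
    rw [SetLike.mem_coe, MonoidAlgebra.mem_supported']
    intro γ hγ
    by_contra hne
    refine hγ (Finset.mem_coe.2 (Finset.mem_biUnion.2 ⟨z, hz, ?_⟩))
    rw [← (hξ z hz).2, coeff_translate] at hne
    rw [← Finset.inv_smul_mem_iff]
    exact Finsupp.mem_support_iff.2 hne
  have hcard : F.card ≤ U.card := by
    refine Finset.card_le_card_of_injOn (fun x => x * s) ?_ fun x _ y _ h => mul_right_cancel h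
    intro x hx
    have h1 := hsupp (single_mul_mem_translateSpan a hx)
    rw [MonoidAlgebra.mem_supported'] at h1
    by_contra hne
    have h2 := h1 _ hne
    rw [coeff_translate, inv_mul_cancel_left] at h2
    exact Finsupp.mem_support_iff.1 hs h2
  refine hcard.trans ((Finset.card_biUnion_le_card_mul t _ a.coeff.support.card fun z _ => ?_).trans ?_)
  · rw [Finset.card_smul_finset]
  · exact Nat.mul_le_mul_right _ htcard.le

/-! ### Compressions of convolution operators -/

/-- The matrix of the right multiplication by `a`, compressed to the finite set `F`. -/
noncomputable def compress (F : Finset Γ) : MonoidAlgebra K Γ →ₗ[K] Matrix F F K where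
  toFun a := Matrix.of fun x y => a.coeff ((x : Γ)⁻¹ * y)
  map_add' _ _ := rfl
  map_smul' _ _ := rfl

theorem compress_apply (F : Finset Γ) (a : MonoidAlgebra K Γ) (x y : F) :
    compress F a x y = a.coeff ((x : Γ)⁻¹ * y) := rfl

/-- The number of pairs of a point of `F` and an element of the support of `a` whose product is not
in `F`. -/
noncomputable def supportEscape (a : MonoidAlgebra K Γ) (F : Finset Γ) : ℕ :=
  ∑ s ∈ a.coeff.support, escape s F

theorem card_filter_support_le (a : MonoidAlgebra K Γ) (F : Finset Γ) :
    (F.filter fun x => ∃ s ∈ a.coeff.support, x * s ∉ F).card ≤ supportEscape a F := by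
  refine (Finset.card_le_card (t := a.coeff.support.biUnion fun s => F.filter fun x => x * s ∉ F)
    fun x hx => ?_).trans Finset.card_biUnion_le
  rw [Finset.mem_filter] at hx
  obtain ⟨hx, s, hs, hxs⟩ := hx
  exact Finset.mem_biUnion.2 ⟨s, hs, Finset.mem_filter.2 ⟨hx, hxs⟩⟩

theorem rank_compress_le (a : MonoidAlgebra K Γ) (F : Finset Γ) :
    (compress F a).rank ≤ Module.finrank K (translateSpan a F) := by
  let ρ : MonoidAlgebra K Γ →ₗ[K] (F → K) :=
    { toFun := fun z x => z.coeff x, map_add' := fun _ _ => rfl, map_smul' := fun _ _ => rfl }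
  rw [(compress F a).rank_eq_finrank_span_row]
  refine (Submodule.finrank_mono (t := (translateSpan a F).map ρ) ?_).trans
    (Submodule.finrank_map_le _ _)
  rw [Submodule.span_le]
  rintro _ ⟨x, rfl⟩
  exact ⟨_, single_mul_mem_translateSpan a x.2, funext fun y => coeff_translate a x y⟩

/-- For `x` outside the boundary set `E`, the translate of `a` by `x` is supported on `F`, so
restriction to `F` loses nothing; the points of `E` add at most `|E|` dimensions. -/
theorem finrank_translateSpan_le (a : MonoidAlgebra K Γ) (F : Finset Γ) :
    Module.finrank K (translateSpan a F) ≤ (compress F a).rank + supportEscape a F := by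
  have hh := isInvariantSubadditive_finrank_translateSpan a
  set E := F.filter fun x => ∃ s ∈ a.coeff.support, x * s ∉ F with hE
  have h1 := hh.union_le (F \ E) E
  rw [Finset.sdiff_union_of_subset (Finset.filter_subset _ _)] at h1
  refine h1.trans (Nat.add_le_add ?_ ((hh.le_card E).trans (card_filter_support_le a F)))
  let ρ : MonoidAlgebra K Γ →ₗ[K] (F → K) :=
    { toFun := fun z x => z.coeff x, map_add' := fun _ _ => rfl, map_smul' := fun _ _ => rfl }
  have hsupp : translateSpan a (F \ E) ≤ MonoidAlgebra.supported K K (F : Set Γ) := by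
    refine translateSpan_le.2 fun x hx => ?_
    rw [MonoidAlgebra.mem_supported']
    intro γ hγ
    rw [coeff_translate]
    by_contra hne
    rw [Finset.mem_sdiff, hE, Finset.mem_filter] at hx
    refine hx.2 ⟨hx.1, x⁻¹ * γ, Finsupp.mem_support_iff.2 hne, ?_⟩
    rwa [mul_inv_cancel_left]
  have hinj : Set.InjOn ρ (translateSpan a (F \ E)) := by
    intro z hz w hw h
    have hz' := MonoidAlgebra.mem_supported'.1 (hsupp hz)
    have hw' := MonoidAlgebra.mem_supported'.1 (hsupp hw)
    ext γ
    by_cases hγ : γ ∈ F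
    · exact congrFun h ⟨γ, hγ⟩
    · rw [hz' γ hγ, hw' γ hγ]
  have hrank : Module.finrank K ((translateSpan a (F \ E)).map ρ) =
      Module.finrank K (translateSpan a (F \ E)) := by
    rw [← LinearMap.range_domRestrict]
    refine LinearMap.finrank_range_of_inj ?_
    intro z w h
    exact Subtype.ext (hinj z.2 w.2 h)
  change Module.finrank K (translateSpan a (F \ E)) ≤ _
  rw [(compress F a).rank_eq_finrank_span_row, ← hrank]
  refine Submodule.finrank_mono ?_
  rw [Submodule.map_le_iff_le_comap, translateSpan_le]
  intro x hx
  refine Submodule.subset_span ⟨⟨x, (Finset.mem_sdiff.1 hx).1⟩, ?_⟩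
  exact funext fun y => (coeff_translate a x y).symm

/-- The row of `x` vanishes if `x * supp a ⊆ F`: all intermediate points of the convolution then lie
in `F`. The support of `b` does not matter. -/
theorem rank_compress_mul_sub_le (a b : MonoidAlgebra K Γ) (F : Finset Γ) :
    (compress F (a * b) - compress F a * compress F b).rank ≤ supportEscape a F := by
  refine (rank_le_card_of_row_eq_zero _
    (Finset.univ.filter fun x : F => ∃ s ∈ a.coeff.support, (x : Γ) * s ∉ F) ?_).trans
    (le_trans (Finset.card_le_card_of_injOn Subtype.val ?_ Subtype.val_injective.injOn)
      (card_filter_support_le a F))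
  · intro x hx
    by_contra hcon
    refine hx (funext fun y => ?_)
    simp only [Finset.mem_filter, Finset.mem_univ, true_and, not_exists, not_and, not_not] at hcon
    rw [Matrix.sub_apply, Matrix.mul_apply, Pi.zero_apply, sub_eq_zero]
    simp only [compress_apply]
    rw [MonoidAlgebra.coeff_mul_apply_left, Finsupp.sum]
    -- The default value `x` is never taken on the support of `a`, by `hcon`.
    refine Finset.sum_of_injOn (fun s => if h : (x : Γ) * s ∈ F then ⟨x * s, h⟩ else x) ?_ ?_ ?_ ?_
    · intro s hs t ht h
      simp only [hcon s hs, hcon t ht, dite_true, Subtype.mk.injEq] at h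
      exact mul_left_cancel h
    · intro s _
      exact Finset.mem_coe.2 (Finset.mem_univ _)
    · intro w _ hw
      by_cases hs : (x : Γ)⁻¹ * w ∈ a.coeff.support
      · refine absurd ⟨_, hs, ?_⟩ hw
        simp
      · rw [Finsupp.notMem_support_iff.1 hs, zero_mul]
    · intro s hs
      simp only [hcon s hs, dite_true]
      simp [mul_assoc]
  · intro x hx
    simp only [Finset.coe_filter, Finset.mem_univ, true_and, Set.mem_ofPred_eq] at hx ⊢
    exact ⟨x.2, hx⟩

/-- A nonzero entry joins different tiles by a step in `supp a`, so its row belongs to a point that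
leaves its tile under that step. Such points are counted tile by tile. -/
theorem rank_le_sum_supportEscape {𝒯 : Finset (Finset Γ)} {C : Option 𝒯 → Finset Γ} {F : Finset Γ}
    (hC : IsTiling 𝒯 C F) (a : MonoidAlgebra K Γ) (A : Matrix F F K)
    (hA : ∀ x y : F, A x y ≠ 0 → (x : Γ)⁻¹ * y ∈ a.coeff.support ∧
      ∀ t, ∀ c ∈ C t, c⁻¹ * (x : Γ) ∈ tileShape 𝒯 t → c⁻¹ * (y : Γ) ∉ tileShape 𝒯 t) :
    A.rank ≤ ∑ t, (C t).card * supportEscape a (tileShape 𝒯 t) := by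
  let S : Finset F := Finset.univ.biUnion fun t => (C t).biUnion fun c =>
    a.coeff.support.biUnion fun s => Finset.univ.filter fun x : F =>
      c⁻¹ * (x : Γ) ∈ tileShape 𝒯 t ∧ c⁻¹ * (x : Γ) * s ∉ tileShape 𝒯 t
  refine (rank_le_card_of_row_eq_zero A S ?_).trans ?_
  · intro x hx
    obtain ⟨y, hy⟩ := Function.ne_iff.1 hx
    obtain ⟨hs, h⟩ := hA x y hy
    obtain ⟨t, c, hc, hct⟩ := hC.cover x x.2
    simp only [S, Finset.mem_biUnion, Finset.mem_filter, Finset.mem_univ, true_and]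
    exact ⟨t, c, hc, _, hs, hct, by simpa [mul_assoc] using h t c hc hct⟩
  · refine Finset.card_biUnion_le.trans (Finset.sum_le_sum fun t _ => ?_)
    refine Finset.card_biUnion_le_card_mul _ _ _ fun c _ => ?_
    refine Finset.card_biUnion_le.trans (Finset.sum_le_sum fun s _ => ?_)
    refine Finset.card_le_card_of_injOn (fun x : F => c⁻¹ * (x : Γ)) ?_ ?_
    · intro x hx
      simpa using hx
    · intro x _ y _ h
      exact Subtype.ext (mul_left_cancel h)

theorem eventually_supportEscape_le (a : MonoidAlgebra K Γ) {δ : ℝ} (hδ : 0 < δ) :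
    ∀ᶠ F in folnerFilter Γ, (supportEscape a F : ℝ) ≤ δ * F.card := by
  filter_upwards [eventually_sum_escape_le a.coeff.support hδ] with F hF
  rw [supportEscape]
  exact_mod_cast hF

/-- The limit of the normalized ranks of the compressions of `a`. -/
theorem exists_tendsto_rank_compress (a : MonoidAlgebra K Γ) : ∃ r : ℝ,
    Tendsto (fun F => ((compress F a).rank : ℝ) / F.card) (folnerFilter Γ) (𝓝 r) ∧
    IsFolnerRank a r ∧ ((folnerFilter Γ).NeBot → a ≠ 0 → 0 < r) := by
  obtain ⟨r, hr⟩ := (isInvariantSubadditive_finrank_translateSpan a).exists_tendsto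
  refine ⟨r, ?_, ?_, ?_⟩
  · have h0 : Tendsto (fun F => (Module.finrank K (translateSpan a F) : ℝ) / F.card -
        ((compress F a).rank : ℝ) / F.card) (folnerFilter Γ) (𝓝 0) := by
      rw [Metric.tendsto_nhds]
      intro δ hδ
      filter_upwards [eventually_supportEscape_le a (half_pos hδ),
        eventually_folner_nonempty] with F hF hne
      have hpos : (0 : ℝ) < F.card := by exact_mod_cast hne.card_pos
      have h1 : ((compress F a).rank : ℝ) ≤ Module.finrank K (translateSpan a F) := by
        exact_mod_cast rank_compress_le a F
      have h2 : (Module.finrank K (translateSpan a F) : ℝ) ≤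
          (compress F a).rank + supportEscape a F := by
        exact_mod_cast finrank_translateSpan_le a F
      rw [Real.dist_eq, sub_zero, ← sub_div, abs_of_nonneg (div_nonneg (by linarith) hpos.le),
        div_lt_iff₀ hpos]
      nlinarith
    simpa using hr.sub h0
  · intro S hS F hF
    have h1 := (hr.comp (hF.tendsto_folnerFilter hS)).const_sub 1
    refine h1.congr fun n => ?_
    have hpos : ((F n).card : ℝ) ≠ 0 := by exact_mod_cast (hF.1 n).card_pos.ne'
    have h2 : (Module.finrank K (translateSpan a (F n)) : ℝ) +
        Module.finrank K (annihilatorOn (F n) a) = (F n).card := by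
      exact_mod_cast finrank_translateSpan_add_annihilatorOn a (F n)
    rw [Function.comp_apply]
    field_simp
    linarith
  · intro _ ha
    have hs : (0 : ℝ) < a.coeff.support.card := by
      rw [Nat.cast_pos, Finset.card_pos, Finsupp.support_nonempty_iff]
      simpa using ha
    -- Every non-empty `F` already satisfies the bound `1 / |supp a|`; it passes to the limit
    -- because the filter is nontrivial.
    refine lt_of_lt_of_le (inv_pos.2 hs) (ge_of_tendsto hr ?_)
    filter_upwards [eventually_folner_nonempty] with F hne
    have hpos : (0 : ℝ) < F.card := by exact_mod_cast hne.card_pos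
    rw [le_div_iff₀ hpos, inv_mul_le_iff₀ hs, mul_comm]
    exact_mod_cast card_le_card_support_mul_finrank_translateSpan ha F

end GroupAlgebraRank

/-! ### Harmonic weights -/

/-- A point mass on a good vertex of a high level induces a distribution on each lower level. These
are harmonic below the starting level, and a limit as that level tends to infinity is harmonic
throughout. -/
theorem exists_harmonic_weight {V : ℕ → Type u} [∀ n, Fintype (V n)]
    (p : ∀ n, V n → V (n + 1) → ℝ) (hp : ∀ n α β, 0 ≤ p n α β) (hp1 : ∀ n β, ∑ α, p n α β = 1)
    (bad good : ∀ n, V n) (hgood : ∀ n, good n ≠ bad n)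
    (hbad : ∀ n β, β ≠ bad (n + 1) → p n (bad n) β ≤ (1 / 2) ^ (n + 1)) :
    ∃ w : ∀ n, V n → ℝ, (∀ n α, 0 ≤ w n α) ∧ (∀ n, ∑ α, w n α = 1) ∧
      (∀ n α, w n α = ∑ β, p n α β * w (n + 1) β) ∧ ∀ n, w n (bad n) ≤ (1 / 2) ^ n := by
  classical
  -- `u k n` is the distribution on level `n` induced by the point mass at `good (n + k)`.
  let u : ℕ → ∀ n, V n → ℝ := fun k => Nat.rec (fun n => Pi.single (good n) 1)
    (fun _ u n α => ∑ β, p n α β * u (n + 1) β) k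
  have hu0 : ∀ n, u 0 n = Pi.single (good n) 1 := fun _ => rfl
  have hus : ∀ k n α, u (k + 1) n α = ∑ β, p n α β * u k (n + 1) β := fun _ _ _ => rfl
  have hnonneg : ∀ k n α, 0 ≤ u k n α := by
    intro k
    induction k with
    | zero =>
      intro n α
      rw [hu0, Pi.single_apply]
      split_ifs <;> norm_num
    | succ k ih =>
      intro n α
      rw [hus]
      exact Finset.sum_nonneg fun β _ => mul_nonneg (hp _ _ _) (ih _ _)
  have hsum : ∀ k n, ∑ α, u k n α = 1 := by
    intro k
    induction k with
    | zero => intro n; simp [hu0]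
    | succ k ih =>
      intro n
      simp_rw [hus]
      rw [Finset.sum_comm]
      simp_rw [← Finset.sum_mul, hp1, one_mul, ih]
  have hle : ∀ k n α, u k n α ≤ 1 := by
    intro k n α
    rw [← hsum k n]
    exact Finset.single_le_sum (fun α _ => hnonneg k n α) (Finset.mem_univ α)
  have hub : ∀ k n, u k n (bad n) ≤ (1 / 2) ^ n := by
    intro k
    induction k with
    | zero =>
      intro n
      rw [hu0, Pi.single_eq_of_ne (hgood n).symm]
      positivity
    | succ k ih =>
      intro n
      rw [hus]
      -- Mass at `bad n` comes from vertices other than `bad (n + 1)`, with share at most `(1 / 2) ^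
      -- (n + 1)`, or from `bad (n + 1)`, whose total mass is at most `(1 / 2) ^ (n + 1)` by
      -- induction. The two bounds add up to `(1 / 2) ^ n`.
      have h1 : ∀ β, p n (bad n) β * u k (n + 1) β ≤ (1 / 2) ^ (n + 1) * u k (n + 1) β +
          if β = bad (n + 1) then u k (n + 1) β else 0 := by
        intro β
        have h0 := hnonneg k (n + 1) β
        split_ifs with h
        · have hle1 : p n (bad n) β ≤ 1 := by
            rw [← hp1 n β]
            exact Finset.single_le_sum (fun α _ => hp n α β) (Finset.mem_univ (bad n))
          have : (0 : ℝ) ≤ (1 / 2) ^ (n + 1) * u k (n + 1) β := by positivity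
          nlinarith
        · rw [add_zero]
          exact mul_le_mul_of_nonneg_right (hbad n β h) h0
      refine (Finset.sum_le_sum fun β _ => h1 β).trans ?_
      rw [Finset.sum_add_distrib, ← Finset.mul_sum, hsum, Finset.sum_ite_eq' Finset.univ]
      simp only [Finset.mem_univ, if_true]
      have := ih (n + 1)
      calc (1 / 2 : ℝ) ^ (n + 1) * 1 + u k (n + 1) (bad (n + 1))
          ≤ (1 / 2) ^ (n + 1) * 1 + (1 / 2) ^ (n + 1) := by gcongr
        _ = (1 / 2) ^ n := by ring
  -- An ultrafilter makes all coordinates converge at once. The truncated difference `N - n` is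
  -- harmless, since `N ≥ n + 1` holds eventually.
  have hlim : ∀ n α, ∃ x ∈ Set.Icc (0 : ℝ) 1,
      Tendsto (fun N => u (N - n) n α) (hyperfilter ℕ : Filter ℕ) (𝓝 x) := by
    intro n α
    have h := isCompact_Icc.ultrafilter_le_nhds' (s := Set.Icc (0 : ℝ) 1)
      ((hyperfilter ℕ).map fun N => u (N - n) n α)
      (Ultrafilter.mem_map.2 (Filter.univ_mem' fun N => ⟨hnonneg _ _ _, hle _ _ _⟩))
    obtain ⟨x, hx, h⟩ := h
    exact ⟨x, hx, h⟩
  choose w hw hlim using hlim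
  refine ⟨w, fun n α => (hw n α).1, fun n => ?_, fun n α => ?_, fun n => ?_⟩
  · refine tendsto_nhds_unique (tendsto_finsetSum Finset.univ fun α _ => hlim n α) ?_
    simp_rw [hsum]
    exact tendsto_const_nhds
  · refine tendsto_nhds_unique (hlim n α) ((tendsto_finsetSum Finset.univ fun β _ =>
      (hlim (n + 1) β).const_mul (p n α β)).congr' ?_)
    have h : ∀ᶠ N in (hyperfilter ℕ : Filter ℕ), n + 1 ≤ N :=
      Nat.hyperfilter_le_atTop (eventually_ge_atTop (n + 1))
    filter_upwards [h] with N hN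
    obtain ⟨k, rfl⟩ := Nat.exists_eq_add_of_le hN
    have e1 : n + 1 + k - n = k + 1 := by omega
    have e2 : n + 1 + k - (n + 1) = k := by omega
    rw [e1, e2, hus]
  · exact le_of_tendsto (hlim n _) (Eventually.of_forall fun N => hub _ _)

/-! ### The ultramatricial system of a sequence of tilings -/

section TilingSystem

open scoped Pointwise
open scoped Classical

variable {Γ : Type u} [Group Γ]

/-- The points of a tiled set, listed as points of the tiles. -/
noncomputable def IsTiling.equiv {𝒯 : Finset (Finset Γ)} {C : Option 𝒯 → Finset Γ} {F : Finset Γ}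
    (h : IsTiling 𝒯 C F) (p : Option 𝒯 → Prop) (hp : ∀ t, (C t).Nonempty → p t) :
    (Σ k : (Σ t : {t // p t}, Fin (C t).card), tileShape 𝒯 k.1) ≃ F :=
  Equiv.ofBijective
    (fun q => ⟨(C q.1.1).equivFin.symm q.1.2 * q.2, h.mem _ _ (Subtype.prop _) _ q.2.2⟩) (by
      constructor
      · rintro ⟨⟨⟨t, ht⟩, i⟩, y⟩ ⟨⟨⟨t', ht'⟩, i'⟩, y'⟩ hq
        simp only [Subtype.mk.injEq] at hq
        obtain ⟨rfl, hc⟩ := h.unique ((C t).equivFin.symm i * y) t t' _ _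
          ((C t).equivFin.symm i).2 ((C t').equivFin.symm i').2
          (by rw [inv_mul_cancel_left]; exact y.2)
          (by rw [hq, inv_mul_cancel_left]; exact y'.2)
        have hi : i = i' := (C t).equivFin.symm.injective (Subtype.ext hc)
        subst hi
        have hy : y = y' := Subtype.ext (mul_left_cancel hq)
        rw [hy]
      · rintro ⟨x, hx⟩
        obtain ⟨t, c, hc, hct⟩ := h.cover x hx
        refine ⟨⟨⟨⟨t, hp t ⟨c, hc⟩⟩, (C t).equivFin ⟨c, hc⟩⟩, ⟨c⁻¹ * x, hct⟩⟩, ?_⟩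
        simp)

theorem IsTiling.card_eq {𝒯 : Finset (Finset Γ)} {C : Option 𝒯 → Finset Γ} {F : Finset Γ}
    (h : IsTiling 𝒯 C F) : F.card = ∑ t, (C t).card * (tileShape 𝒯 t).card := by
  have e := Fintype.card_congr (h.equiv (fun _ => True) fun _ _ => trivial)
  rw [Fintype.card_coe] at e
  rw [← e, Fintype.card_sigma, Fintype.sum_sigma]
  simp only [Fintype.card_coe]
  rw [← Equiv.sum_comp (Equiv.subtypeUnivEquiv (p := fun _ : Option 𝒯 => True) fun _ => trivial)]
  refine Finset.sum_congr rfl fun t _ => ?_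
  simp

/-- The singleton is itself a vertex of every level and must be tiled by the level below; it is
tiled by the singleton there. -/
theorem isTiling_singleton (𝒯 : Finset (Finset Γ)) :
    IsTiling 𝒯 (fun t => if t = none then {1} else ∅) {1} := by
  refine ⟨?_, ?_, ?_⟩
  · rintro (_ | T) c hc y hy
    · simp only [if_true, Finset.mem_singleton, tileShape] at hc hy ⊢
      simp [hc, hy]
    · simp at hc
  · intro x hx
    rw [Finset.mem_singleton] at hx
    exact ⟨none, 1, by simp, by simp [tileShape, hx]⟩
  · rintro x (_ | T) (_ | T') c c' hc hc' - -
    · simp only [if_true, Finset.mem_singleton] at hc hc'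
      exact ⟨rfl, hc.trans hc'.symm⟩
    all_goals simp at hc hc'

/-- A sequence of finite families of finite sets, such that the members of each family are tiled by
the members of the previous one, with a compatible sequence of frequencies of the tiles. -/
structure TilingSequence (Γ : Type u) [Group Γ] where
  /-- the family of level `n` -/
  tiles : ℕ → Finset (Finset Γ)
  nonempty : ∀ n, ∀ T ∈ tiles n, T.Nonempty
  /-- the set of centers of the translates of a tile -/
  center : ∀ n, Option (tiles (n + 1)) → Option (tiles n) → Finset Γ
  isTiling : ∀ n β, IsTiling (tiles n) (center n β) (tileShape (tiles (n + 1)) β)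
  /-- the frequency of a tile -/
  freq : ∀ n, Option (tiles n) → ℝ
  freq_nonneg : ∀ n α, 0 ≤ freq n α
  freq_sum : ∀ n, ∑ α, freq n α = 1
  freq_harmonic : ∀ n α, freq n α = ∑ β, ((tileShape (tiles n) α).card : ℝ) *
    ((center n β α).card : ℝ) / ((tileShape (tiles (n + 1)) β).card : ℝ) * freq (n + 1) β
  freq_none_le : ∀ n, freq n none ≤ (1 / 2) ^ n

theorem tileShape_nonempty {𝒯 : Finset (Finset Γ)} (h : ∀ T ∈ 𝒯, T.Nonempty) (t : Option 𝒯) :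
    (tileShape 𝒯 t).Nonempty := by
  rcases t with _ | T
  · exact Finset.singleton_nonempty 1
  · exact h T T.2

theorem exists_tilingSequence [(folnerFilter Γ).NeBot] {W : ℕ → Finset Γ → Prop}
    (hW : ∀ n, ∀ᶠ F in folnerFilter Γ, W n F) :
    ∃ D : TilingSequence Γ, ∀ n, ∀ T ∈ D.tiles n, W n T := by
  obtain ⟨𝒯, hne, h𝒯, htiled⟩ := exists_tile_sequence hW (ε := fun n => (1 / 2) ^ (n + 1))
    (fun n => by positivity) (fun n => pow_lt_one₀ (by norm_num) (by norm_num) (by simp))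
  have hT : ∀ n β, ∃ C : Option (𝒯 n) → Finset Γ,
      IsTiling (𝒯 n) C (tileShape (𝒯 (n + 1)) β) ∧ (β ≠ none →
        ((C none).card : ℝ) ≤ (1 / 2) ^ (n + 1) * (tileShape (𝒯 (n + 1)) β).card) := by
    rintro n (_ | T)
    · exact ⟨_, isTiling_singleton (𝒯 n), fun h => absurd rfl h⟩
    · obtain ⟨C, h1, h2⟩ := htiled n T T.2
      exact ⟨C, h1, fun _ => h2⟩
  choose C hC hCnone using hT
  have hpos : ∀ n t, (0 : ℝ) < (tileShape (𝒯 n) t).card := fun n t => by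
    exact_mod_cast (tileShape_nonempty (fun T hT => (h𝒯 n T hT).2) t).card_pos
  obtain ⟨w, hw0, hw1, hw2, hw3⟩ := exists_harmonic_weight
    (fun n α β => ((tileShape (𝒯 n) α).card : ℝ) * ((C n β α).card : ℝ) /
      ((tileShape (𝒯 (n + 1)) β).card : ℝ))
    (fun n α β => by positivity) (fun n β => by
      rw [← Finset.sum_div, div_eq_one_iff_eq (hpos _ _).ne', (hC n β).card_eq]
      push_cast
      exact Finset.sum_congr rfl fun _ _ => mul_comm _ _)
    (fun _ => none) (fun n => some ⟨(hne n).choose, (hne n).choose_spec⟩) (fun n => by simp)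
    (fun n β hβ => by
      rw [div_le_iff₀ (hpos _ _)]
      simpa [tileShape] using hCnone n β hβ)
  exact ⟨⟨𝒯, fun n T hT => (h𝒯 n T hT).2, C, hC, w, hw0, hw1, hw2, hw3⟩,
    fun n T hT => (h𝒯 n T hT).1⟩

namespace TilingSequence

variable (D : TilingSequence Γ)

/-- The set of points of a tile. -/
abbrev shape (n : ℕ) (α : Option (D.tiles n)) : Finset Γ := tileShape (D.tiles n) α

theorem shape_nonempty (n : ℕ) (α : Option (D.tiles n)) : (D.shape n α).Nonempty :=
  tileShape_nonempty (D.nonempty n) α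

theorem card_shape_pos (n : ℕ) (α : Option (D.tiles n)) : (0 : ℝ) < (D.shape n α).card := by
  exact_mod_cast (D.shape_nonempty n α).card_pos

/-- By harmonicity, every tile occurring in a tile of positive frequency has positive frequency.
Tiles of frequency zero can thus be discarded, as strict positivity of the weight requires, without
leaving gaps in the blocks. -/
theorem freq_pos_of_center_nonempty {n : ℕ} {β : Option (D.tiles (n + 1))} (hβ : 0 < D.freq (n + 1) β)
    (α : Option (D.tiles n)) (h : (D.center n β α).Nonempty) : 0 < D.freq n α := by
  rw [D.freq_harmonic]
  refine Finset.sum_pos' (fun β' _ => mul_nonneg (by positivity) (D.freq_nonneg _ _))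
    ⟨β, Finset.mem_univ _, ?_⟩
  have h1 := D.card_shape_pos n α
  have h2 := D.card_shape_pos (n + 1) β
  have h3 : (0 : ℝ) < (D.center n β α).card := by exact_mod_cast h.card_pos
  positivity

theorem sum_pos_freq (n : ℕ) (f : Option (D.tiles n) → ℝ) (hf : ∀ α, D.freq n α = 0 → f α = 0) :
    ∑ α : {α // 0 < D.freq n α}, f α = ∑ α, f α := by
  rw [← Finset.sum_subtype (Finset.univ.filter fun α => 0 < D.freq n α) (by simp) f]
  refine Finset.sum_filter_of_ne fun α _ h => ?_
  exact (D.freq_nonneg n α).lt_of_ne fun h0 => h (hf α h0.symm)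

/-- The ultramatricial system of a tiling sequence. The vertices are the tiles of positive
frequency. -/
noncomputable def system : UltramatricialSystem.{u} where
  V n := {α : Option (D.tiles n) // 0 < D.freq n α}
  fintypeV _ := inferInstance
  decEqV _ := inferInstance
  X n α := D.shape n α.1
  fintypeX _ _ := inferInstance
  decEqX _ _ := inferInstance
  nonemptyX n α := (D.shape_nonempty n α.1).to_subtype
  mult n α β := (D.center n β.1 α.1).card
  block n β := (D.isTiling n β.1).equiv _ (D.freq_pos_of_center_nonempty β.2)
  weight n α := D.freq n α.1
  weight_pos n α := α.2
  weight_sum n := by rw [D.sum_pos_freq n (D.freq n) fun _ h => h, D.freq_sum]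
  weight_harmonic n α := by
    rw [D.freq_harmonic]
    simp only [Fintype.card_coe]
    exact (D.sum_pos_freq (n + 1) _ fun β h => by rw [h, mul_zero]).symm

end TilingSequence

end TilingSystem

/-! ### The embedding of the group algebra -/

theorem UltramatricialSystem.of_step (D : UltramatricialSystem.{u}) {K : Type v} [Field K] (n : ℕ)
    (x : D.Level K n) : D.of K (n + 1) (D.step K n x) = D.of K n x := by
  have h : D.trans K n (n + 1) n.le_succ x = D.step K n x := by
    rw [UltramatricialSystem.trans, Nat.leRecOn_succ le_rfl, Nat.leRecOn_self]
    rfl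
  rw [← h]
  exact (DirectLimit.eq_of_le (f := fun i j h => D.trans K i j h) ⟨n, x⟩ (n + 1) n.le_succ).symm

namespace TilingSequence

open scoped Classical

variable {Γ : Type u} [Group Γ] (D : TilingSequence Γ)

/-- The tiles of level `n` are asymptotically invariant, with exponential speed. -/
def IsFine : Prop := ∀ γ : Γ, ∀ᶠ n in atTop, ∀ T ∈ D.tiles n,
  (escape γ T : ℝ) ≤ (1 / 2) ^ n * T.card

variable {D}

theorem IsFine.eventually_sum_escape_le (hD : D.IsFine) (B : Finset Γ) : ∀ᶠ n in atTop,
    ∀ T ∈ D.tiles n, (∑ b ∈ B, (escape b T : ℝ)) ≤ B.card * ((1 / 2) ^ n * T.card) := by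
  have h : ∀ᶠ n in atTop, ∀ b ∈ B, ∀ T ∈ D.tiles n, (escape b T : ℝ) ≤ (1 / 2) ^ n * T.card :=
    (Finset.eventually_all B).2 fun b _ => hD b
  filter_upwards [h] with n hn T hT
  rw [← nsmul_eq_mul]
  exact Finset.sum_le_card_nsmul _ _ _ fun b hb => hn b hb T hT

theorem IsFine.eventually_forall_tiles (hD : D.IsFine) {p : Finset Γ → Prop}
    (hp : ∀ᶠ F in folnerFilter Γ, p F) : ∀ᶠ n in atTop, ∀ T ∈ D.tiles n, p T := by
  obtain ⟨B, δ, hδ, H⟩ := eventually_folner_iff.1 hp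
  have h0 : Tendsto (fun n : ℕ => (B.card : ℝ) * (1 / 2) ^ n) atTop (𝓝 0) := by
    simpa using (tendsto_pow_atTop_nhds_zero_of_lt_one (r := (1 / 2 : ℝ)) (by norm_num)
      (by norm_num)).const_mul (B.card : ℝ)
  filter_upwards [hD.eventually_sum_escape_le B, h0.eventually_le_const hδ] with n h1 h2 T hT
  refine H T (D.nonempty n T hT) ((h1 T hT).trans ?_)
  rw [← mul_assoc]
  gcongr

/-- Level `n` is made invariant only under the first `n + 1` elements of an enumeration of the
group, which reaches each element eventually. -/
theorem exists_isFine [(folnerFilter Γ).NeBot] [Countable Γ] : ∃ D : TilingSequence Γ, D.IsFine := by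
  obtain ⟨e, he⟩ := exists_surjective_nat Γ
  obtain ⟨D, hD⟩ := exists_tilingSequence (Γ := Γ)
    (W := fun n F => ∀ i ∈ Finset.range (n + 1), (escape (e i) F : ℝ) ≤ (1 / 2) ^ n * F.card)
    fun n => (Finset.eventually_all _).2 fun i _ => by
      simpa using eventually_sum_escape_le {e i} (δ := (1 / 2) ^ n) (by positivity)
  refine ⟨D, fun γ => ?_⟩
  obtain ⟨i, rfl⟩ := he γ
  filter_upwards [eventually_ge_atTop i] with n hn T hT
  exact hD n T hT i (Finset.mem_range.2 (by omega))

variable (D) {K : Type v} [Field K]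

/-- The average over the tiles of level `n` of the normalized boundary with respect to the support
of `a`. -/
noncomputable def boundaryMass (n : ℕ) (a : MonoidAlgebra K Γ) : ℝ :=
  ∑ α, D.freq n α * ((supportEscape a (D.shape n α) : ℝ) / (D.shape n α).card)

theorem boundaryMass_nonneg (n : ℕ) (a : MonoidAlgebra K Γ) : 0 ≤ D.boundaryMass n a :=
  Finset.sum_nonneg fun α _ => mul_nonneg (D.freq_nonneg n α) (by positivity)

/-- An average over the tiles of level `n` is controlled by the values at the proper tiles. -/
theorem sum_freq_mul_le (n : ℕ) (f : Option (D.tiles n) → ℝ) {c M : ℝ} (hc : 0 ≤ c) (hM : 0 ≤ M)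
    (h0 : f none ≤ M) (h : ∀ T, f (some T) ≤ c) :
    ∑ α, D.freq n α * f α ≤ (1 / 2) ^ n * M + c := by
  have h1 := D.freq_sum n
  have h2 := D.freq_none_le n
  rw [Fintype.sum_option] at h1 ⊢
  have h3 : ∑ T, D.freq n (some T) * f (some T) ≤ ∑ T, D.freq n (some T) * c :=
    Finset.sum_le_sum fun T _ => mul_le_mul_of_nonneg_left (h T) (D.freq_nonneg _ _)
  rw [← Finset.sum_mul] at h3
  have h4 := D.freq_nonneg n none
  have h5 : D.freq n none * f none ≤ (1 / 2) ^ n * M :=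
    (mul_le_mul_of_nonneg_left h0 h4).trans (mul_le_mul_of_nonneg_right h2 hM)
  have h6 : ∑ T, D.freq n (some T) ≤ 1 := by linarith
  nlinarith

variable {D}

/-- Half of the bound comes from the proper tiles, which are almost invariant, and half from the
singleton, which is all boundary but has small frequency. The geometric rate gives summability. -/
theorem IsFine.eventually_boundaryMass_le (hD : D.IsFine) (a : MonoidAlgebra K Γ) :
    ∀ᶠ n in atTop, D.boundaryMass n a ≤ 2 * a.coeff.support.card * (1 / 2) ^ n := by
  filter_upwards [hD.eventually_sum_escape_le a.coeff.support] with n hn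
  have h := D.sum_freq_mul_le n
    (fun α => (supportEscape a (D.shape n α) : ℝ) / (D.shape n α).card)
    (c := a.coeff.support.card * (1 / 2) ^ n) (M := a.coeff.support.card)
    (by positivity) (by positivity) ?_ ?_
  · refine h.trans (le_of_eq ?_)
    ring
  · rw [div_le_iff₀ (D.card_shape_pos n none)]
    have h : supportEscape a (D.shape n none) ≤ a.coeff.support.card * (D.shape n none).card := by
      rw [supportEscape, ← smul_eq_mul]
      exact Finset.sum_le_card_nsmul _ _ _ fun s _ => escape_le_card _ _
    exact_mod_cast h
  · intro T
    rw [div_le_iff₀ (D.card_shape_pos n (some T)), mul_assoc, supportEscape]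
    push_cast
    exact hn T T.2

theorem IsFine.tendsto_boundaryMass (hD : D.IsFine) (a : MonoidAlgebra K Γ) :
    Tendsto (fun n => D.boundaryMass n a) atTop (𝓝 0) := by
  refine squeeze_zero' (Eventually.of_forall fun n => D.boundaryMass_nonneg n a)
    (hD.eventually_boundaryMass_le a) ?_
  simpa using (tendsto_pow_atTop_nhds_zero_of_lt_one (r := (1 / 2 : ℝ)) (by norm_num)
    (by norm_num)).const_mul (2 * a.coeff.support.card : ℝ)

theorem IsFine.summable_boundaryMass (hD : D.IsFine) (a : MonoidAlgebra K Γ) :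
    Summable fun n => D.boundaryMass n a := by
  have h : Summable fun n : ℕ => 2 * (a.coeff.support.card : ℝ) * (1 / 2) ^ n :=
    (summable_geometric_of_lt_one (by norm_num) (by norm_num)).mul_left _
  refine h.of_norm_bounded_eventually_nat ?_
  filter_upwards [hD.eventually_boundaryMass_le a] with n hn
  rwa [Real.norm_of_nonneg (D.boundaryMass_nonneg n a)]

variable (D)

theorem levelRank_eq (n : ℕ) (f : Option (D.tiles n) → ℝ) (x : D.system.Level K n)
    (hx : ∀ α : D.system.V n, ((x α).rank : ℝ) = f α.1) :
    D.system.levelRank n x = ∑ α, D.freq n α * (f α / (D.shape n α).card) := by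
  rw [← D.sum_pos_freq n _ fun α h => by rw [h, zero_mul]]
  refine Finset.sum_congr rfl fun α _ => ?_
  rw [hx]
  congr 2
  exact congrArg Nat.cast (Fintype.card_coe _)

theorem levelRank_le (n : ℕ) (f : Option (D.tiles n) → ℕ) (x : D.system.Level K n)
    (hx : ∀ α : D.system.V n, (x α).rank ≤ f α.1) :
    D.system.levelRank n x ≤ ∑ α, D.freq n α * ((f α : ℝ) / (D.shape n α).card) := by
  rw [← D.sum_pos_freq n _ fun α h => by rw [h, zero_mul]]
  refine Finset.sum_le_sum fun α _ => mul_le_mul_of_nonneg_left ?_ (D.freq_nonneg n _)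
  have h : (Fintype.card (D.system.X n α) : ℝ) = (D.shape n α.1).card :=
    congrArg Nat.cast (Fintype.card_coe _)
  rw [h]
  have := hx α
  gcongr

/-- The compressions of the right multiplication by an element of the group algebra to the tiles of
level `n`. -/
noncomputable def levelMap (n : ℕ) : MonoidAlgebra K Γ →ₗ[K] D.system.Level K n :=
  LinearMap.pi fun α => compress (D.shape n α.1)

theorem levelMap_one (n : ℕ) : D.levelMap n (1 : MonoidAlgebra K Γ) = 1 := by
  funext α
  ext x y
  have h : D.levelMap n (1 : MonoidAlgebra K Γ) α x y =
    (1 : MonoidAlgebra K Γ).coeff (x.1⁻¹ * y.1) := rfl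
  rw [h, Pi.one_apply, Matrix.one_apply, MonoidAlgebra.one_def, MonoidAlgebra.coeff_single,
    Finsupp.single_apply]
  have e : (1 : Γ) = x.1⁻¹ * y.1 ↔ x = y := by
    rw [eq_comm, inv_mul_eq_one]
    exact Subtype.ext_iff.symm
  simp only [e]

theorem levelMap_star (n : ℕ) (a : MonoidAlgebra ℂ Γ) :
    D.levelMap n (groupAlgebraStar a) = star (D.levelMap n a) := by
  have hstar : ∀ γ : Γ, (groupAlgebraStar a).coeff γ = star (a.coeff γ⁻¹) := by
    intro γ
    rw [groupAlgebraStar, MonoidAlgebra.coeff_finsuppSum, Finsupp.sum_apply, Finsupp.sum]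
    simp only [MonoidAlgebra.coeff_single, Finsupp.single_apply, inv_eq_iff_eq_inv]
    rw [Finset.sum_ite_eq']
    split_ifs with h
    · rfl
    · rw [Finsupp.notMem_support_iff.1 h, star_zero]
  funext α
  ext x y
  have h : D.levelMap n (groupAlgebraStar a) α x y = (groupAlgebraStar a).coeff (x.1⁻¹ * y.1) := rfl
  have h' : star (D.levelMap n a) α x y = star (a.coeff (y.1⁻¹ * x.1)) := rfl
  rw [h, h', hstar, mul_inv_rev, inv_inv]

theorem levelRank_levelMap_mul_sub_le (n : ℕ) (a b : MonoidAlgebra K Γ) :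
    D.system.levelRank n (D.levelMap n (a * b) - D.levelMap n a * D.levelMap n b) ≤
      D.boundaryMass n a :=
  D.levelRank_le n (fun α => supportEscape a (D.shape n α)) _ fun α =>
    rank_compress_mul_sub_le a b (D.shape n α.1)

theorem step_apply (n : ℕ) (x : D.system.Level K n) (β : D.system.V (n + 1))
    (p q : Σ k : (Σ α : D.system.V n, Fin (D.system.mult n α β)), D.system.X n k.1) :
    D.system.step K n x β (D.system.block n β p) (D.system.block n β q) =
      Matrix.blockDiagonal' (fun k : (Σ α : D.system.V n, Fin (D.system.mult n α β)) => x k.1)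
        p q := by
  change Matrix.reindex (D.system.block n β) (D.system.block n β) _ _ _ = _
  simp [Matrix.reindex_apply]

/-- Inside one tile both matrices agree, since the compression is invariant under left translation.
The difference is supported on entries between different tiles, and `rank_le_sum_supportEscape`
applies. -/
theorem levelRank_levelMap_sub_step_le (n : ℕ) (a : MonoidAlgebra K Γ) :
    D.system.levelRank (n + 1) (D.levelMap (n + 1) a - D.system.step K n (D.levelMap n a)) ≤
      D.boundaryMass n a := by
  refine (D.levelRank_le (n + 1) (fun β => ∑ α, (D.center n β α).card *
    supportEscape a (D.shape n α)) _ fun β => ?_).trans (le_of_eq ?_)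
  · refine rank_le_sum_supportEscape (D.isTiling n β.1) a _ ?_
    intro x y hxy
    obtain ⟨⟨k, i⟩, rfl⟩ := (D.system.block n β).surjective x
    obtain ⟨⟨l, j⟩, rfl⟩ := (D.system.block n β).surjective y
    have hT := D.isTiling n β.1
    let c : (Σ α : D.system.V n, Fin (D.system.mult n α β)) → Γ :=
      fun k => (D.center n β.1 k.1.1).equivFin.symm k.2
    have hc : ∀ k, c k ∈ D.center n β.1 k.1.1 := fun k =>
      ((D.center n β.1 k.1.1).equivFin.symm k.2).2
    have hinj : ∀ k l, k.1.1 = l.1.1 → c k = c l → k = l := by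
      rintro ⟨⟨t, ht⟩, i⟩ ⟨⟨t', ht'⟩, j⟩ h h'
      obtain rfl : t = t' := h
      have hij : i = j := (D.center n β.1 t).equivFin.symm.injective (Subtype.ext h')
      rw [hij]
    have hblock : ∀ k i, (D.system.block n β ⟨k, i⟩ : D.shape (n + 1) β.1).1 =
      c k * (i : D.shape n k.1.1).1 := fun _ _ => rfl
    have hentry : (D.levelMap (n + 1) a - D.system.step K n (D.levelMap n a)) β
        (D.system.block n β ⟨k, i⟩) (D.system.block n β ⟨l, j⟩) =
        a.coeff ((c k * (i : D.shape n k.1.1).1)⁻¹ * (c l * (j : D.shape n l.1.1).1)) -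
          Matrix.blockDiagonal' (fun k : (Σ α : D.system.V n, Fin (D.system.mult n α β)) =>
            D.levelMap n a k.1) ⟨k, i⟩ ⟨l, j⟩ := by
      rw [← D.step_apply n (D.levelMap n a) β]
      rfl
    have hkl : k ≠ l := by
      rintro rfl
      refine hxy (hentry.trans ?_)
      rw [Matrix.blockDiagonal'_apply_eq, mul_inv_rev, mul_assoc, inv_mul_cancel_left]
      exact sub_self _
    have hne : a.coeff ((c k * (i : D.shape n k.1.1).1)⁻¹ * (c l * (j : D.shape n l.1.1).1)) ≠ 0 := by
      intro h0
      refine hxy (hentry.trans ?_)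
      rw [Matrix.blockDiagonal'_apply_ne _ _ _ hkl, h0, sub_zero]
    refine ⟨Finsupp.mem_support_iff.2 hne, fun t d hd hx hy => hkl ?_⟩
    have hx' := hT.unique _ _ _ _ _ (hc k) hd
      (by rw [hblock k i, inv_mul_cancel_left]; exact i.2) hx
    have hy' := hT.unique _ _ _ _ _ (hc l) hd
      (by rw [hblock l j, inv_mul_cancel_left]; exact j.2) hy
    exact hinj k l (hx'.1.trans hy'.1.symm) (hx'.2.trans hy'.2.symm)
  -- Harmonicity of the frequencies turns the average over level `n + 1` of the tile boundaries into
  -- the average over level `n`.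
  · rw [boundaryMass]
    simp_rw [D.freq_harmonic n, Finset.sum_mul]
    rw [Finset.sum_comm]
    refine Finset.sum_congr rfl fun β _ => ?_
    push_cast
    rw [Finset.sum_div, Finset.mul_sum]
    refine Finset.sum_congr rfl fun α _ => ?_
    have h1 := (D.card_shape_pos n α).ne'
    have h2 := (D.card_shape_pos (n + 1) β).ne'
    field_simp

variable {D}

/-- Proper tiles of high level have normalized rank close to `r`. The singleton deviates by at most
`1 + |r|`, with weight at most `(1 / 2) ^ n`. -/
theorem IsFine.tendsto_levelRank (hD : D.IsFine) (a : MonoidAlgebra K Γ) {r : ℝ}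
    (hr : Tendsto (fun F => ((compress F a).rank : ℝ) / F.card) (folnerFilter Γ) (𝓝 r)) :
    Tendsto (fun n => D.system.levelRank n (D.levelMap n a)) atTop (𝓝 r) := by
  rw [Metric.tendsto_nhds]
  intro δ hδ
  have h0 : Tendsto (fun n : ℕ => (1 / 2 : ℝ) ^ n * (1 + |r|)) atTop (𝓝 0) := by
    simpa using (tendsto_pow_atTop_nhds_zero_of_lt_one (r := (1 / 2 : ℝ)) (by norm_num)
      (by norm_num)).mul_const (1 + |r|)
  filter_upwards [hD.eventually_forall_tiles ((Metric.tendsto_nhds.1 hr) (δ / 3) (by positivity)),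
    h0.eventually_le_const (show (0 : ℝ) < δ / 3 by positivity)] with n h1 h2
  rw [D.levelRank_eq n (fun α => ((compress (D.shape n α) a).rank : ℝ)) (D.levelMap n a)
    fun _ => rfl, Real.dist_eq]
  have e : r = ∑ α, D.freq n α * r := by rw [← Finset.sum_mul, D.freq_sum, one_mul]
  have h3 := D.sum_freq_mul_le n
    (fun α => |((compress (D.shape n α) a).rank : ℝ) / (D.shape n α).card - r|)
    (c := δ / 3) (M := 1 + |r|) (by positivity) (by positivity) ?_ ?_
  · refine lt_of_le_of_lt ?_ (show (δ / 3 + δ / 3 : ℝ) < δ by linarith)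
    refine le_trans ?_ (h3.trans (add_le_add h2 le_rfl))
    have e' : ∑ α, D.freq n α * (((compress (D.shape n α) a).rank : ℝ) / (D.shape n α).card) - r =
        ∑ α, D.freq n α * (((compress (D.shape n α) a).rank : ℝ) / (D.shape n α).card - r) := by
      simp_rw [mul_sub]
      rw [Finset.sum_sub_distrib, ← e]
    rw [e']
    refine (Finset.abs_sum_le_sum_abs _ _).trans (Finset.sum_le_sum fun α _ => ?_)
    rw [abs_mul, abs_of_nonneg (D.freq_nonneg n α)]
  · refine (abs_sub _ _).trans (add_le_add ?_ le_rfl)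
    rw [abs_of_nonneg (div_nonneg (Nat.cast_nonneg _) (Nat.cast_nonneg _))]
    refine div_le_one_of_le₀ ?_ (Nat.cast_nonneg _)
    have h := (compress (D.shape n none) a).rank_le_card_width
    rw [Fintype.card_coe] at h
    exact_mod_cast h
  · intro T
    have h := h1 T T.2
    rw [Real.dist_eq] at h
    exact h.le

/-! ### Passage to the rank completion -/

variable (D)

/-- The image in the rank completion of the approximation of level `n`. -/
noncomputable def approx (n : ℕ) (a : MonoidAlgebra K Γ) : D.system.RankCompletion K :=
  ((D.system.of K n (D.levelMap n a) : D.system.Alg K) : D.system.RankCompletion K)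

theorem approx_add (n : ℕ) (a b : MonoidAlgebra K Γ) :
    D.approx n (a + b) = D.approx n a + D.approx n b := by
  rw [approx, map_add, map_add, UniformSpace.Completion.coe_add]
  rfl

theorem approx_smul (n : ℕ) (c : K) (a : MonoidAlgebra K Γ) :
    D.approx n (c • a) = c • D.approx n a := by
  rw [approx, map_smul, map_smul, UniformSpace.Completion.coe_smul]
  rfl

theorem approx_one (n : ℕ) : D.approx n (1 : MonoidAlgebra K Γ) = 1 := by
  rw [approx, levelMap_one, map_one, UniformSpace.Completion.coe_one]

theorem approx_star (n : ℕ) (a : MonoidAlgebra ℂ Γ) :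
    D.approx n (groupAlgebraStar a) = star (D.approx n a) := by
  rw [approx, levelMap_star, ← UltramatricialSystem.star_of, ← UltramatricialSystem.star_coe]
  rfl

theorem completionRank_approx (n : ℕ) (a : MonoidAlgebra K Γ) :
    D.system.completionRank (D.approx n a) = D.system.levelRank n (D.levelMap n a) := by
  rw [approx, UltramatricialSystem.completionRank_coe, UltramatricialSystem.rank_of]

theorem dist_approx_succ_le (n : ℕ) (a : MonoidAlgebra K Γ) :
    dist (D.approx n a) (D.approx (n + 1) a) ≤ D.boundaryMass n a := by
  rw [dist_comm, approx, approx, UniformSpace.Completion.dist_eq, UltramatricialSystem.dist_def,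
    ← D.system.of_step n, ← map_sub, UltramatricialSystem.rank_of]
  exact D.levelRank_levelMap_sub_step_le n a

theorem dist_approx_mul_le (n : ℕ) (a b : MonoidAlgebra K Γ) :
    dist (D.approx n (a * b)) (D.approx n a * D.approx n b) ≤ D.boundaryMass n a := by
  rw [approx, approx, approx, ← UniformSpace.Completion.coe_mul, UniformSpace.Completion.dist_eq,
    UltramatricialSystem.dist_def, ← map_mul, ← map_sub, UltramatricialSystem.rank_of]
  exact D.levelRank_levelMap_mul_sub_le n a b

variable {D}

/-- Summability of the boundary masses gives convergence of the approximations; their convergence to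
zero removes the multiplicative defect in the limit. -/
theorem IsFine.exists_algHom (hD : D.IsFine) (K : Type v) [Field K] :
    ∃ φ : MonoidAlgebra K Γ →ₐ[K] D.system.RankCompletion K,
      ∀ a, Tendsto (fun n => D.approx n a) atTop (𝓝 (φ a)) := by
  have h : ∀ a : MonoidAlgebra K Γ, ∃ x, Tendsto (fun n => D.approx n a) atTop (𝓝 x) := fun a =>
    cauchySeq_tendsto_of_complete (cauchySeq_of_dist_le_of_summable _
      (fun n => D.dist_approx_succ_le n a) (hD.summable_boundaryMass a))
  choose f hf using h
  refine ⟨AlgHom.ofLinearMap ⟨⟨f, fun a b => ?_⟩, fun c a => ?_⟩ ?_ fun a b => ?_, hf⟩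
  · refine tendsto_nhds_unique (hf (a + b)) (((hf a).add (hf b)).congr fun n => ?_)
    rw [approx_add]
  · refine tendsto_nhds_unique (hf (c • a)) (((hf a).const_smul c).congr fun n => ?_)
    rw [approx_smul]
  · refine tendsto_nhds_unique (hf 1) (tendsto_const_nhds.congr fun n => ?_)
    rw [approx_one]
  · refine tendsto_nhds_unique (hf (a * b)) (((hf a).mul (hf b)).congr_dist ?_)
    refine squeeze_zero (fun n => dist_nonneg) (fun n => ?_) (hD.tendsto_boundaryMass a)
    rw [dist_comm]
    exact D.dist_approx_mul_le n a b

theorem IsFine.exists_embedding [(folnerFilter Γ).NeBot] (hD : D.IsFine) (K : Type v) [Field K] :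
    ∃ φ : MonoidAlgebra K Γ →ₐ[K] D.system.RankCompletion K,
      (∀ a, Tendsto (fun n => D.approx n a) atTop (𝓝 (φ a))) ∧ Function.Injective φ ∧
      ∀ a, IsFolnerRank a (D.system.completionRank (φ a)) := by
  obtain ⟨φ, hφ⟩ := hD.exists_algHom K
  have hrank : ∀ a : MonoidAlgebra K Γ, ∀ r : ℝ, Tendsto
      (fun F => ((compress F a).rank : ℝ) / F.card) (folnerFilter Γ) (𝓝 r) →
      D.system.completionRank (φ a) = r := by
    intro a r hr
    refine tendsto_nhds_unique ((D.system.continuous_completionRank.tendsto _).comp (hφ a))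
      ((hD.tendsto_levelRank a hr).congr fun n => ?_)
    rw [Function.comp_apply, completionRank_approx]
  refine ⟨φ, hφ, (injective_iff_map_eq_zero φ).2 fun a ha => ?_, fun a => ?_⟩
  · by_contra hne
    obtain ⟨r, hr, -, hpos⟩ := exists_tendsto_rank_compress a
    have h := hpos inferInstance hne
    rw [← hrank a r hr, ha, UltramatricialSystem.completionRank, dist_self] at h
    exact lt_irrefl _ h
  · obtain ⟨r, hr, hr', -⟩ := exists_tendsto_rank_compress a
    rwa [hrank a r hr]

end TilingSequence

/-! ### Countability of finitely generated groups and the main theorem -/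

theorem countable_of_fg (Γ : Type u) [Group Γ] [Group.FG Γ] : Countable Γ := by
  obtain ⟨S, hS, hfin⟩ := Group.fg_iff.1 ‹Group.FG Γ›
  have : Countable (S ∪ S⁻¹ : Set Γ) :=
    (hfin.countable.union hfin.inv.countable).to_subtype
  refine Function.Surjective.countable
    (f := fun l : List (S ∪ S⁻¹ : Set Γ) => (l.map Subtype.val).prod) fun x => ?_
  have hx : x ∈ Submonoid.closure (S ∪ S⁻¹) := by
    rw [← Subgroup.closure_toSubmonoid, hS]
    exact Subgroup.mem_top x
  obtain ⟨l, hl, rfl⟩ := Submonoid.exists_list_of_mem_closure hx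
  lift l to List (S ∪ S⁻¹ : Set Γ) using hl
  exact ⟨l, rfl⟩

theorem theorem2 (Γ : Type u) [Group Γ] [Group.FG Γ] (hΓ : IsAmenableGroup Γ) :
    (∀ (K : Type v) [Field K],
      ∃ (D : UltramatricialSystem.{u}) (φ : MonoidAlgebra K Γ →ₐ[K] D.RankCompletion K),
        Function.Injective φ ∧
        ∀ a : MonoidAlgebra K Γ, IsFolnerRank a (D.completionRank (φ a))) ∧
    (∃ (D : UltramatricialSystem.{u}) (φ : MonoidAlgebra ℂ Γ →ₐ[ℂ] D.RankCompletion ℂ),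
        Function.Injective φ ∧
        (∀ a : MonoidAlgebra ℂ Γ, IsFolnerRank a (D.completionRank (φ a))) ∧
        ∀ a : MonoidAlgebra ℂ Γ, φ (groupAlgebraStar a) = star (φ a)) := by
  have := hΓ.neBot
  have := countable_of_fg Γ
  -- The tilings and frequencies depend only on the group, so one system serves all fields. Over `ℂ`
  -- the same limit is a `*`-homomorphism, since every approximation respects the involution
  -- exactly.
  obtain ⟨D, hD⟩ := TilingSequence.exists_isFine (Γ := Γ)
  refine ⟨fun K _ => ?_, ?_⟩
  · obtain ⟨φ, -, h⟩ := hD.exists_embedding K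
    exact ⟨D.system, φ, h⟩
  · obtain ⟨φ, hφ, hinj, hrank⟩ := hD.exists_embedding ℂ
    refine ⟨D.system, φ, hinj, hrank, fun a => ?_⟩
    refine tendsto_nhds_unique (hφ _) (((continuous_star.tendsto _).comp (hφ a)).congr fun n => ?_)
    rw [Function.comp_apply, TilingSequence.approx_star]
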